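/- Let $G$ be $U(1)$ (with $N=1$) or $SU(2)$ (with $N=2$), let $M$ be a finite-dimensional real analytic manifold (Hausdorff, second countable, without boundary), let $P$ be a smooth principal $G$-bundle over $M$, and fix $u_0\in P$ lying over $\star\in M$. Let $\mathcal A$ be the set of smooth principal connections on $P$. For a continuous, piecewise analytic loop $\alpha$ in $M$ based at $\star$ and $A\in\mathcal A$, the holonomy $H_A(\alpha)\in G$ is defined by $u_0=\mathcal P^A_\alpha(u_0)\,H_A(\alpha)$, where $\mathcal P^A_\alpha(u_0)$ is the end point of the $A$-horizontal lift of $\alpha$ starting at $u_0$. The Wilson function of $\alpha$ is the bounded gauge-invariant function $T_\alpha(A)=\frac1N\operatorname{Tr}H_A(\alpha)$ on $\mathcal A$, and $\mathcal W=\{T_\alpha\}$ is the set of all Wilson functions. Let $\mathrm{Hol}(M,G)$ be the commutative unital $C^*$-algebra generated by $\mathcal W$ in the algebra of bounded complex functions on $\mathcal A$ with the supremum norm, let $\overline{\mathcal A/\mathcal G}$ be its Gelfand spectrum (a compact Hausdorff space), and write $T_\alpha(\bar A)=\bar A(T_\alpha)$ for $\bar A\in\overline{\mathcal A/\mathcal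 G}$. Let $M(\overline{\mathcal A/\mathcal G})$ be the space of complex regular Borel measures on $\overline{\mathcal A/\mathcal G}$ with the total variation norm, $M_+(\overline{\mathcal A/\mathcal G})$ its cone of positive measures, and $\mathcal B(\mathcal W)$ the space of bounded complex functions on $\mathcal W$ with the supremum norm. A function $\ell:\mathcal W\to\mathbb C$ is called positive definite if, for all $n$, all $c_1,\dots,c_n\in\mathbb C$ and all $T_{\alpha_1},\dots,T_{\alpha_n}\in\mathcal W$, one has $\sum_{i=1}^n c_i\,\ell(T_{\alpha_i})\ge 0$ whenever $\sum_{i=1}^n c_i\,T_{\alpha_i}(\bar A)\ge 0$ for every $\bar A\in\overline{\mathcal A/\mathcal G}$ (here $z\ge0$ means that $z$ is real and non-negative); $\mathcal P(\mathcal W)$ denotes the set of these functions. For $\mu\in M(\overline{\mathcal A/\mathcal G})$ put $$\ell_\mu(T_\alpha)=\int_{\overline{\mathcal A/\mathcal G}}\overline{T_\alpha(\bar A)}\,d\mu(\bar A).$$ Then: 1. $\mathcal L:\mu\mapsto\ell_\mu$ is a well-defined, continuous, injective linear map $M(\overline{\mathcal A/\mathcal G})\to\mathcal B(\mathcal W)$.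 2. The restriction of $\mathcal L$ to $M_+(\overline{\mathcal A/\mathcal G})$ is a bijection onto $\mathcal P(\mathcal W)$. -/

import Mathlib

open Set MeasureTheory
open scoped Manifold ContDiff ENNReal ComplexOrder

noncomputable section

namespace LoopTransform

/-! ### Structure groups -/

/-- The group `SU(N)`, as a subgroup of `U(N)`. -/
def SU (N : ℕ) : Subgroup (Matrix.unitaryGroup (Fin N) ℂ) :=
  MonoidHom.ker (Matrix.detMonoidHom.comp (Matrix.unitaryGroup (Fin N) ℂ).subtype)

/-- `G` is one of the two gauge groups `U(1)` and `SU(2)`. -/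
inductive IsU1OrSU2 : ∀ {N : ℕ}, Subgroup (Matrix.unitaryGroup (Fin N) ℂ) → Prop
  | u1 : IsU1OrSU2 (N := 1) ⊤
  | su2 : IsU1OrSU2 (SU 2)

/-- The underlying matrix of an element of `G ≤ U(N)`. -/
def mat {N : ℕ} {G : Subgroup (Matrix.unitaryGroup (Fin N) ℂ)} (g : G) :
    Matrix (Fin N) (Fin N) ℂ :=
  ((g : Matrix.unitaryGroup (Fin N) ℂ) : Matrix (Fin N) (Fin N) ℂ)

/-- The Lie algebra of a matrix group `G ≤ U(N)`. -/
def lieAlg {N : ℕ} (G : Subgroup (Matrix.unitaryGroup (Fin N) ℂ)) :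
    Set (Matrix (Fin N) (Fin N) ℂ) :=
  {X | ∀ t : ℝ, ∃ g : G, mat g = NormedSpace.exp (t • X)}

/-! ### Principal bundles and connections -/

/-- A smooth principal `G`-bundle with total space `P` over `M`: a right action of `G` on `P` whose
orbits are the fibres of `proj` and which is free, together with an atlas of equivariant local
trivializations `p ↦ (proj p, coord i p)` from `proj ⁻¹' dom i` to `dom i × G`, whose transition
functions are smooth. The topology and the smooth structure of `P` are those that make these
trivializations diffeomorphisms. -/
structure PrincipalBundle {N : ℕ} (G : Subgroup (Matrix.unitaryGroup (Fin N) ℂ))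
    (E : Type*) [NormedAddCommGroup E] [NormedSpace ℝ E]
    (M : Type*) [TopologicalSpace M] [ChartedSpace E M] (P : Type*) where
  proj : P → M
  proj_surjective : Function.Surjective proj
  act : P → G → P
  act_one : ∀ p, act p 1 = p
  act_mul : ∀ p g h, act p (g * h) = act (act p g) h
  proj_act : ∀ p g, proj (act p g) = proj p
  existsUnique_act : ∀ p q, proj p = proj q → ∃! g, act p g = q
  /-- index type of the atlas of local trivializations -/
  ι : Type*
  dom : ι → Set M
  isOpen_dom : ∀ i, IsOpen (dom i)
  cover : ∀ x, ∃ i, x ∈ dom i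
  coord : ι → P → G
  coord_act : ∀ i p g, proj p ∈ dom i → coord i (act p g) = coord i p * g
  /-- transition functions -/
  trans : ι → ι → M → G
  coord_eq : ∀ i j p, proj p ∈ dom i → proj p ∈ dom j →
    coord i p = trans i j (proj p) * coord j p
  smooth_trans : ∀ i j k l,
    ContMDiffOn 𝓘(ℝ, E) 𝓘(ℝ, ℂ) ∞ (fun x => mat (trans i j x) k l) (dom i ∩ dom j)

section

variable {N : ℕ} {G : Subgroup (Matrix.unitaryGroup (Fin N) ℂ)}
  {E : Type*} [NormedAddCommGroup E] [NormedSpace ℝ E]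
  {M : Type*} [TopologicalSpace M] [ChartedSpace E M] [IsManifold 𝓘(ℝ, E) ω M] {P : Type*}

/-- A smooth principal connection, given by its local connection forms: `form i` is the pull-back
to `dom i`, along the section on which `coord i = 1`, of the connection form on `P`. It is a smooth
`1`-form on `dom i` with values in the Lie algebra of `G`, and on overlaps
`Aⱼ = gᵢⱼ⁻¹ Aᵢ gᵢⱼ + gᵢⱼ⁻¹ dgᵢⱼ`. A `1`-form is smooth iff it is smooth as a function on the tangent
bundle. Outside `dom i` the form `form i` is set to zero, so that a connection is determined by its
local forms and conversely. -/
structure Connection (B : PrincipalBundle G E M P) where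
  form : B.ι → ∀ x : M, TangentSpace 𝓘(ℝ, E) x →ₗ[ℝ] Matrix (Fin N) (Fin N) ℂ
  form_mem : ∀ i, ∀ x ∈ B.dom i, ∀ v, form i x v ∈ lieAlg G
  smooth_form : ∀ i k l,
    ContMDiffOn (𝓘(ℝ, E)).tangent 𝓘(ℝ, ℂ) ∞
      (fun p : TangentBundle 𝓘(ℝ, E) M => form i p.1 p.2 k l)
      (Bundle.TotalSpace.proj ⁻¹' B.dom i)
  form_trans : ∀ i j, ∀ x ∈ B.dom i, x ∈ B.dom j → ∀ v : TangentSpace 𝓘(ℝ, E) x,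
    form j x v =
      mat (B.trans i j x)⁻¹ * form i x v * mat (B.trans i j x)
        + mat (B.trans i j x)⁻¹ * Matrix.of (fun k l =>
            (mfderiv 𝓘(ℝ, E) 𝓘(ℝ, ℂ) (fun y => mat (B.trans i j y) k l) x v : ℂ))
  form_off : ∀ i, ∀ x ∉ B.dom i, form i x = 0

/-! ### Loops and holonomy -/

variable (E) in
/-- A (parametrized) continuous piecewise analytic loop in `M` based at `x₀`, on an interval
`[a, b]`; the values of `toFun` outside `[a, b]` are irrelevant. -/
structure PLoop (x₀ : M) where
  toFun : ℝ → M
  a : ℝ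
  b : ℝ
  le : a ≤ b
  continuousOn : ContinuousOn toFun (Icc a b)
  piecewise_analytic : ∃ (n : ℕ) (t : ℕ → ℝ), Monotone t ∧ t 0 = a ∧ t n = b ∧
    ∀ i < n, ContMDiffOn 𝓘(ℝ, ℝ) 𝓘(ℝ, E) ω toFun (Icc (t i) (t (i + 1)))
  source : toFun a = x₀
  target : toFun b = x₀

/-- `u` is a horizontal lift of the loop `γ` for the connection `A`: it is continuous and, off a
finite set of parameters, its coordinate `h` in the `i`-th local trivialization solves
`h' = - Aᵢ(γ') h`. -/
def IsHorizontalLift {B : PrincipalBundle G E M P} (A : Connection B) {x₀ : M} (γ : PLoop E x₀)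
    (u : ℝ → P) : Prop :=
  (∀ t ∈ Icc γ.a γ.b, B.proj (u t) = γ.toFun t) ∧
  (∀ i k l, ContinuousOn (fun t => mat (B.coord i (u t)) k l)
    (Icc γ.a γ.b ∩ γ.toFun ⁻¹' B.dom i)) ∧
  ∃ S : Set ℝ, S.Finite ∧ ∀ t ∈ Ioo γ.a γ.b \ S, ∀ i, γ.toFun t ∈ B.dom i → ∀ k l,
    HasDerivAt (fun s => mat (B.coord i (u s)) k l)
      (-(A.form i (γ.toFun t) (mfderiv 𝓘(ℝ, ℝ) 𝓘(ℝ, E) γ.toFun t (1 : ℝ))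
        * mat (B.coord i (u t))) k l) t

/-- The holonomy `H_A(γ) ∈ G` with respect to `u₀`, defined by `u₀ = P_γ(u₀) · H_A(γ)`, where the
parallel transport `P_γ(u₀)` is the end point of the horizontal lift of `γ` starting at `u₀`. -/
def holonomy {B : PrincipalBundle G E M P} (A : Connection B) (u₀ : P)
    (γ : PLoop E (B.proj u₀)) : G :=
  Classical.epsilon fun g : G =>
    ∃ u : ℝ → P, IsHorizontalLift A γ u ∧ u γ.a = u₀ ∧ u₀ = B.act (u γ.b) g

/-! ### Wilson functions, the holonomy C*-algebra and its spectrum -/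

lemma norm_trace_le (g : G) : ‖(1 / (N : ℂ)) * (mat g).trace‖ ≤ ‖(1 / (N : ℂ))‖ * N := by
  rw [norm_mul]
  gcongr
  calc ‖(mat g).trace‖ ≤ ∑ i : Fin N, ‖mat g i i‖ := norm_sum_le _ _
    _ ≤ ∑ _i : Fin N, (1 : ℝ) :=
        Finset.sum_le_sum fun i _ =>
          entry_norm_bound_of_unitary (g : Matrix.unitaryGroup (Fin N) ℂ).2 i i
    _ = N := by simp

/-- The discrete topology on the space of connections. It serves only to regard all bounded
functions on this space as bounded continuous functions. -/
instance (B : PrincipalBundle G E M P) : TopologicalSpace (Connection B) := ⊥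

instance (B : PrincipalBundle G E M P) : DiscreteTopology (Connection B) := ⟨rfl⟩

/-- The C*-algebra of all bounded complex functions on the space of connections, with the
supremum norm. -/
abbrev BddFun (B : PrincipalBundle G E M P) : Type _ :=
  BoundedContinuousFunction (Connection B) ℂ

/-- The Wilson function `T_γ(A) = (1/N) Tr H_A(γ)`. -/
def wilson (B : PrincipalBundle G E M P) (u₀ : P) (γ : PLoop E (B.proj u₀)) : BddFun B :=
  BoundedContinuousFunction.ofNormedAddCommGroupDiscrete
    (fun A => (1 / (N : ℂ)) * (mat (holonomy A u₀ γ)).trace) (‖(1 / (N : ℂ))‖ * N)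
    (fun _ => norm_trace_le _)

/-- The set `𝒲` of all Wilson functions. -/
def wilsonSet (B : PrincipalBundle G E M P) (u₀ : P) : Set (BddFun B) :=
  range (wilson B u₀)

/-- The holonomy C*-algebra `Hol(M, G)`: the closure in the supremum norm of the *-algebra
generated by the Wilson functions. -/
def Hol (B : PrincipalBundle G E M P) (u₀ : P) : StarSubalgebra ℂ (BddFun B) :=
  (StarAlgebra.adjoin ℂ (wilsonSet B u₀)).topologicalClosure

lemma wilsonSet_subset_Hol (B : PrincipalBundle G E M P) (u₀ : P) {f : BddFun B}
    (hf : f ∈ wilsonSet B u₀) : f ∈ Hol B u₀ :=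
  StarSubalgebra.le_topologicalClosure _ (StarAlgebra.subset_adjoin ℂ _ hf)

lemma isClosed_Hol (B : PrincipalBundle G E M P) (u₀ : P) :
    IsClosed (Hol B u₀ : Set (BddFun B)) :=
  StarSubalgebra.isClosed_topologicalClosure _

instance (B : PrincipalBundle G E M P) (u₀ : P) : CompleteSpace (Hol B u₀) :=
  (isClosed_Hol B u₀).completeSpace_coe

/-- The space of generalized connections: the Gelfand spectrum of `Hol(M, G)`. -/
abbrev GenConn (B : PrincipalBundle G E M P) (u₀ : P) : Type _ :=
  WeakDual.characterSpace ℂ (Hol B u₀)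

instance (B : PrincipalBundle G E M P) (u₀ : P) : MeasurableSpace (GenConn B u₀) := borel _

instance (B : PrincipalBundle G E M P) (u₀ : P) : BorelSpace (GenConn B u₀) := ⟨rfl⟩

/-- The value `T(Ā)` of a Wilson function at a generalized connection, i.e. its Gelfand
transform. -/
def evalAt {B : PrincipalBundle G E M P} {u₀ : P} (T : wilsonSet B u₀) (Abar : GenConn B u₀) : ℂ :=
  Abar (⟨T, wilsonSet_subset_Hol B u₀ T.2⟩ : Hol B u₀)

/-- Positive definite functions on `𝒲`. -/
def PosDef (B : PrincipalBundle G E M P) (u₀ : P) : Set (wilsonSet B u₀ → ℂ) :=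
  {ℓ | ∀ (n : ℕ) (c : Fin n → ℂ) (T : Fin n → wilsonSet B u₀),
    (∀ Abar : GenConn B u₀, 0 ≤ ∑ i, c i * evalAt (T i) Abar) → 0 ≤ ∑ i, c i * ℓ (T i)}

end

/-! ### Complex regular measures -/

section Measures

variable {X : Type*} [TopologicalSpace X] [T2Space X] [MeasurableSpace X] [BorelSpace X]

lemma regular_of_le {ρ m : Measure X} [IsFiniteMeasure m] [m.Regular] (h : ρ ≤ m) :
    ρ.Regular := by
  have hfin : IsFiniteMeasure ρ := ⟨(h univ).trans_lt (measure_lt_top m univ)⟩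
  have : ρ.InnerRegularCompactLTTop := by
    constructor
    rintro s ⟨hs, -⟩ r hr
    obtain ⟨K, hKs, hK, hlt⟩ := hs.exists_isCompact_sdiff_lt (μ := m) (measure_ne_top m s)
      (tsub_pos_of_lt hr).ne'
    refine ⟨K, hKs, hK, ?_⟩
    by_contra! hcon
    have h1 : ρ s ≤ ρ K + ρ (s \ K) := by
      rw [add_comm]
      exact (measure_mono (by intro x hx; by_cases hxK : x ∈ K <;> simp [hx, hxK])).trans
        (measure_union_le (s \ K) K)
    have h2 : ρ (s \ K) < ρ s - r := (h _).trans_lt hlt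
    have h3 : ρ K + ρ (s \ K) < r + (ρ s - r) :=
      ENNReal.add_lt_add_of_le_of_lt (measure_ne_top ρ K) hcon h2
    rw [add_tsub_cancel_of_le hr.le] at h3
    exact absurd h1 (not_le.2 h3)
  infer_instance

variable [CompactSpace X]

variable (X) in
/-- The space of complex regular (Borel) measures on a compact Hausdorff space: the complex
measures whose total variation is regular. -/
def RegMeas : Submodule ℂ (ComplexMeasure X) where
  carrier := {μ | μ.variation.Regular}
  zero_mem' := by
    simp only [mem_ofPred_eq, VectorMeasure.variation_zero]
    infer_instance
  add_mem' {μ ν} hμ hν := by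
    simp only [mem_ofPred_eq] at hμ hν ⊢
    have h1 : IsFiniteMeasure μ.variation := inferInstance
    have h2 : IsFiniteMeasure ν.variation := inferInstance
    have : (μ.variation + ν.variation).Regular := inferInstance
    exact regular_of_le VectorMeasure.variation_add_le
  smul_mem' c μ hμ := by
    simp only [mem_ofPred_eq, VectorMeasure.variation_smul] at hμ ⊢
    infer_instance

instance (μ : RegMeas X) : (μ : ComplexMeasure X).variation.Regular := μ.2

instance (μ : RegMeas X) : IsFiniteMeasure (μ : ComplexMeasure X).variation := inferInstance

/-- The total variation norm. -/
instance : Norm (RegMeas X) := ⟨fun μ => (μ : ComplexMeasure X).variation.real univ⟩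

lemma norm_def (μ : RegMeas X) : ‖μ‖ = (μ : ComplexMeasure X).variation.real univ := rfl

lemma normCore : NormedSpace.Core ℂ (RegMeas X) where
  norm_nonneg μ := measureReal_nonneg
  norm_smul c μ := by
    simp [norm_def, VectorMeasure.variation_smul, measureReal_def]
  norm_triangle μ ν := by
    simp only [norm_def, measureReal_def]
    rw [← ENNReal.toReal_add (measure_ne_top _ _) (measure_ne_top _ _)]
    exact ENNReal.toReal_mono (by simp) (VectorMeasure.variation_add_le univ)
  norm_eq_zero_iff μ := by
    simp [norm_def, measureReal_eq_zero_iff]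

instance : NormedAddCommGroup (RegMeas X) := NormedAddCommGroup.ofCore normCore

instance : NormedSpace ℂ (RegMeas X) := NormedSpace.ofCore normCore

variable (X) in
/-- The cone of positive regular measures. -/
def PosMeas : Set (RegMeas X) :=
  {μ | ∀ s, MeasurableSet s → 0 ≤ (μ : ComplexMeasure X) s}

/-- The integral of a complex function against a complex measure. -/
def cintegral (μ : ComplexMeasure X) (f : X → ℂ) : ℂ :=
  μ.integral f (ContinuousLinearMap.mul ℝ ℂ)

end Measures

end LoopTransform

end

/-!
The map `μ ↦ ℓ_μ` integrates `μ` against the conjugated Gelfand transforms of the Wilson functions.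
If the span of a set of continuous functions on a compact space is dense, a measure is determined by
its integrals against them. If it also contains `1` and is closed under conjugation, a functional
that is nonnegative on the nonnegative elements of the span is bounded by its value at `1`, hence
extends to a positive functional on all continuous functions, which is a measure by the
Riesz–Markov theorem. For `U(1)` and `SU(2)` the span of the Wilson functions is of this kind: `1`
is the Wilson function of the constant loop, conjugation corresponds to reversing loops, and
products are linear combinations of Wilson functions by the trace identities
`tr g tr h = tr (g h)` on `U(1)` and `tr g tr h = tr (g h) + tr (g h⁻¹)` on `SU(2)`.

Positive definiteness involves `T_α` while `ℓ_μ` involves its conjugate, so one has to know that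
`∑ c_i T_i ≥ 0` on the spectrum if and only if `∑ c_i (conj T_i) ≥ 0` there. Smooth connections are
dense in the spectrum. On `SU(2)` traces are real. On `U(1)` it suffices to find, for a connection
`A` and finitely many loops, a connection `A'` with inverse holonomies along these loops. Loops are
one-dimensional, so the Hermitian line bundle associated with `P` has a smooth section `s` that has
length one along all of them. Reflecting `A` in `s`, that is, reversing the sign of its form in the
gauge given by `s`, yields `A'`.
-/

noncomputable section

namespace LoopTransform

open scoped Matrix.Norms.Frobenius

/-! ### Integration against complex measures -/

section ComplexMeasure

variable {X : Type*} [MeasurableSpace X] {μ : ComplexMeasure X} {ν : Measure X}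

lemma norm_cintegral_le (μ : ComplexMeasure X) [IsFiniteMeasure μ.variation] {f : X → ℂ} {C : ℝ}
    (hf : ∀ x, ‖f x‖ ≤ C) : ‖cintegral μ f‖ ≤ C * μ.variation.real univ :=
  (VectorMeasure.norm_integral_le_of_norm_le_const (.of_forall hf)).trans (by simp)

lemma mul_mul_eq_compL_mul (c : ℂ) :
    ContinuousLinearMap.mul ℝ ℂ ∘L ContinuousLinearMap.mul ℝ ℂ c =
      ContinuousLinearMap.compL ℝ ℂ ℂ ℂ (ContinuousLinearMap.mul ℝ ℂ c) ∘L
        ContinuousLinearMap.mul ℝ ℂ := by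
  ext
  simp [mul_assoc]

lemma cintegral_const_mul {f : X → ℂ} (hf : μ.Integrable f) (c : ℂ) :
    cintegral μ (fun x => c * f x) = c * cintegral μ f := by
  have hcomp := VectorMeasure.integral_continuousLinearMap_comp
    (B := ContinuousLinearMap.mul ℝ ℂ) (C := ContinuousLinearMap.mul ℝ ℂ c) hf
  rw [mul_mul_eq_compL_mul, ← VectorMeasure.continuousLinearMap_apply_integral hf] at hcomp
  exact hcomp

lemma cintegral_smul_measure {f : X → ℂ} (hf : μ.Integrable f) (c : ℂ) :
    cintegral (c • μ) f = c * cintegral μ f := by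
  have htranspose : ((c • μ).transpose (ContinuousLinearMap.mul ℝ ℂ) : Set X → _) =
      μ.transpose (ContinuousLinearMap.compL ℝ ℂ ℂ ℂ (ContinuousLinearMap.mul ℝ ℂ c) ∘L
        ContinuousLinearMap.mul ℝ ℂ) := by
    ext s x
    exact mul_left_comm x c (μ s)
  have hdom := dominatedFinMeasAdditive_cbmApplyMeasure (c • μ) (ContinuousLinearMap.mul ℝ ℂ)
  rw [htranspose] at hdom
  calc cintegral (c • μ) f = setToFun (c • μ).variation _ hdom f :=
        setToFun_congr_left _ _ htranspose _
    _ = setToFun μ.variation _ (dominatedFinMeasAdditive_cbmApplyMeasure μ _) f :=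
        (setToFun_congr_measure_of_integrable (‖c‖₊ : ℝ≥0∞) (by simp)
          (by rw [VectorMeasure.variation_smul]; rfl) _ hdom f hf).symm
    _ = c * cintegral μ f :=
        (VectorMeasure.continuousLinearMap_apply_integral
          (C := ContinuousLinearMap.mul ℝ ℂ c) hf).symm

/-- A finite positive measure, regarded as a complex measure. -/
def ofMeasure (ν : Measure X) [IsFiniteMeasure ν] : ComplexMeasure X :=
  ν.toSignedMeasure.toComplexMeasure 0

lemma ofMeasure_apply (ν : Measure X) [IsFiniteMeasure ν] {s : Set X} (hs : MeasurableSet s) :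
    ofMeasure ν s = (ν.real s : ℂ) := by
  rw [ofMeasure, SignedMeasure.toComplexMeasure_apply, Measure.toSignedMeasure_apply_measurable hs]
  rfl

lemma variation_ofMeasure (ν : Measure X) [IsFiniteMeasure ν] : (ofMeasure ν).variation = ν := by
  have henorm : ∀ s, MeasurableSet s → ‖ofMeasure ν s‖ₑ = ν s := fun s hs => by
    rw [ofMeasure_apply ν hs, ← ofReal_norm, Complex.norm_real,
      Real.norm_of_nonneg measureReal_nonneg, ofReal_measureReal]
  refine le_antisymm
    (VectorMeasure.variation_le_of_forall_enorm_le fun s hs => (henorm s hs).le) ?_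
  exact Measure.le_iff.2 fun s hs =>
    (henorm s hs).symm.le.trans (VectorMeasure.enorm_measure_le_variation _ _)

lemma integrable_ofMeasure [IsFiniteMeasure ν] {f : X → ℂ} :
    (ofMeasure ν).Integrable f ↔ Integrable f ν := by
  rw [VectorMeasure.Integrable, variation_ofMeasure]

lemma cintegral_ofMeasure [IsFiniteMeasure ν] {f : X → ℂ} (hf : Integrable f ν) :
    cintegral (ofMeasure ν) f = ∫ x, f x ∂ν := by
  have hvar := variation_ofMeasure ν
  refine hf.induction (P := fun g => cintegral (ofMeasure ν) g = ∫ x, g x ∂ν) ?_ ?_ ?_ ?_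
  · intro c s hs _
    have : IsFiniteMeasure (ofMeasure ν).variation := by rw [hvar]; infer_instance
    rw [cintegral, VectorMeasure.integral_indicator_const _ hs, integral_indicator_const _ hs,
      ofMeasure_apply ν hs]
    simp [mul_comm]
  · intro f g _ hf hg hf_eq hg_eq
    rw [integral_add' hf hg, ← hf_eq, ← hg_eq]
    exact VectorMeasure.integral_add (integrable_ofMeasure.2 hf) (integrable_ofMeasure.2 hg)
  · refine isClosed_eq ?_ continuous_integral
    have := VectorMeasure.continuous_integral (μ := ofMeasure ν) (B := ContinuousLinearMap.mul ℝ ℂ)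
    rwa [hvar] at this
  · intro f g hfg _ hf_eq
    rw [← integral_congr_ae hfg, ← hf_eq]
    exact (VectorMeasure.integral_congr_ae (by rwa [hvar])).symm

lemma exists_eq_ofMeasure (hμ : ∀ s, MeasurableSet s → 0 ≤ μ s) :
    ∃ (ν : Measure X) (_ : IsFiniteMeasure ν), μ = ofMeasure ν := by
  have hre : 0 ≤[univ] ComplexMeasure.re μ :=
    VectorMeasure.restrict_le_restrict_of_subset_le _ _ fun s hs _ =>
      (Complex.nonneg_iff.1 (hμ s hs)).1
  refine ⟨(ComplexMeasure.re μ).toMeasureOfZeroLE univ MeasurableSet.univ hre, inferInstance, ?_⟩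
  ext s hs : 1
  rw [ofMeasure, SignedMeasure.toMeasureOfZeroLE_toSignedMeasure,
    SignedMeasure.toComplexMeasure_apply]
  exact Complex.ext rfl (Complex.nonneg_iff.1 (hμ s hs)).2.symm

end ComplexMeasure

section CompactSpace

variable {X : Type*} [TopologicalSpace X] [CompactSpace X] [MeasurableSpace X] [BorelSpace X]

lemma integrable_continuousMap (ν : Measure X) [IsFiniteMeasure ν] (f : C(X, ℂ)) :
    Integrable f ν :=
  (BoundedContinuousFunction.mkOfCompact f).integrable ν

/-- Integration against a complex measure, as a continuous linear functional. -/
def cintegralCLM (μ : ComplexMeasure X) [IsFiniteMeasure μ.variation] : C(X, ℂ) →L[ℂ] ℂ :=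
  LinearMap.mkContinuous
    { toFun := fun f => cintegral μ f
      map_add' := fun f g => VectorMeasure.integral_fun_add (integrable_continuousMap _ f)
        (integrable_continuousMap _ g)
      map_smul' := fun c f => cintegral_const_mul (integrable_continuousMap _ f) c }
    (μ.variation.real univ) fun f =>
      (norm_cintegral_le μ f.norm_coe_le_norm).trans_eq (mul_comm _ _)

@[simp]
lemma cintegralCLM_apply (μ : ComplexMeasure X) [IsFiniteMeasure μ.variation] (f : C(X, ℂ)) :
    cintegralCLM μ f = cintegral μ f := rfl

variable [T2Space X]

lemma eq_zero_of_cintegral_eq_zero (μ : ComplexMeasure X) [μ.variation.Regular]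
    (hμ : ∀ f : C(X, ℂ), cintegral μ f = 0) : μ = 0 := by
  ext s hs : 1
  have hindicator : cintegral μ (s.indicator fun _ => (1 : ℂ)) = μ s := by
    simpa [cintegral] using VectorMeasure.integral_indicator_const (μ := μ)
      (B := ContinuousLinearMap.mul ℝ ℂ) (1 : ℂ) hs
  have hmem : MemLp (s.indicator fun _ => (1 : ℂ)) 1 μ.variation :=
    memLp_indicator_const 1 hs 1 (Or.inr (measure_ne_top _ _))
  rw [FunLike.coe_zero, Pi.zero_apply, ← norm_le_zero_iff]
  refine le_of_forall_pos_le_add fun ε hε => ?_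
  obtain ⟨g, hg, -⟩ := hmem.exists_boundedContinuous_eLpNorm_sub_le ENNReal.one_ne_top
    (ε := ENNReal.ofReal ε) (by simpa using hε)
  rw [eLpNorm_one_eq_lintegral_enorm] at hg
  have hsub : μ s = cintegral μ (s.indicator (fun _ => (1 : ℂ)) - g) := by
    rw [← hindicator, ← sub_zero (cintegral μ _), ← hμ g.toContinuousMap]
    exact (VectorMeasure.integral_sub (memLp_one_iff_integrable.1 hmem) (g.integrable _)).symm
  rw [hsub, zero_add]
  refine VectorMeasure.norm_integral_le_lintegral_norm.trans ?_
  simp only [ContinuousLinearMap.opNorm_mul, one_mul, ofReal_norm]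
  exact ENNReal.toReal_le_of_le_ofReal hε.le hg

lemma eq_zero_of_cintegral_eq_zero_of_dense {s : Set C(X, ℂ)}
    (hs : Dense (Submodule.span ℂ s : Set C(X, ℂ))) (μ : ComplexMeasure X) [μ.variation.Regular]
    (hμ : ∀ f ∈ s, cintegral μ f = 0) : μ = 0 := by
  have hzero : cintegralCLM μ = 0 := ContinuousLinearMap.ext_on hs hμ
  exact eq_zero_of_cintegral_eq_zero μ fun f => DFunLike.congr_fun hzero f

lemma ofMeasure_mem_RegMeas (ν : Measure X) [IsFiniteMeasure ν] [ν.Regular] :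
    ofMeasure ν ∈ RegMeas X := by
  change (ofMeasure ν).variation.Regular
  rwa [variation_ofMeasure]

end CompactSpace

/-! ### Measures as functionals on a spanning set -/

section Extension

lemma linearMap_apply_eq_of_eq_of_isSelfAdjoint {A F : Type*} [AddCommGroup A] [Module ℂ A]
    [StarAddMonoid A] [StarModule ℂ A] [AddCommGroup F] [Module ℂ F] {V : Submodule ℂ A}
    (hstar : ∀ f ∈ V, star f ∈ V) {Λ Λ' : A →ₗ[ℂ] F}
    (h : ∀ f ∈ V, IsSelfAdjoint f → Λ f = Λ' f) {f : A} (hf : f ∈ V) : Λ f = Λ' f := by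
  have hre : (realPart f : A) ∈ V := by
    rw [realPart_apply_coe, ← Complex.coe_smul]
    exact V.smul_mem _ (V.add_mem hf (hstar f hf))
  have him : (imaginaryPart f : A) ∈ V := by
    rw [imaginaryPart_apply_coe, ← Complex.coe_smul]
    exact V.smul_mem _ (V.smul_mem _ (V.sub_mem hf (hstar f hf)))
  rw [← realPart_add_I_smul_imaginaryPart f, map_add, map_add, map_smul, map_smul,
    h _ hre (realPart f).2, h _ him (imaginaryPart f).2]

variable {X : Type*} [TopologicalSpace X] [CompactSpace X] {V : Submodule ℂ C(X, ℂ)}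

lemma im_eq_zero_of_isSelfAdjoint (hone : 1 ∈ V) {Λ : C(X, ℂ) →ₗ[ℂ] ℂ}
    (hΛ : ∀ f ∈ V, 0 ≤ f → 0 ≤ Λ f) {f : C(X, ℂ)} (hf : f ∈ V) (hsa : IsSelfAdjoint f) :
    (Λ f).im = 0 := by
  set c : C(X, ℂ) := algebraMap ℝ C(X, ℂ) ‖f‖
  have hc : c ∈ V := by
    have hsmul : c = (‖f‖ : ℂ) • (1 : C(X, ℂ)) := by
      rw [Complex.coe_smul, ← Algebra.algebraMap_eq_smul_one]
    rw [hsmul]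
    exact V.smul_mem _ hone
  have hc_nonneg : 0 ≤ Λ c := hΛ c hc (algebraMap_nonneg _ (norm_nonneg f))
  have hsub_nonneg : 0 ≤ Λ (c - f) :=
    hΛ _ (V.sub_mem hc hf) (sub_nonneg.2 hsa.le_algebraMap_norm_self)
  rw [map_sub] at hsub_nonneg
  have := (Complex.nonneg_iff.1 hc_nonneg).2
  have := (Complex.nonneg_iff.1 hsub_nonneg).2
  rw [Complex.sub_im] at this
  linarith

variable [T2Space X] [MeasurableSpace X] [BorelSpace X]

lemma exists_measure_of_nonneg_real {D : Submodule ℝ C(X, ℝ)} (hone : 1 ∈ D) (φ : D →ₗ[ℝ] ℝ)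
    (hφ : ∀ f : D, 0 ≤ (f : C(X, ℝ)) → 0 ≤ φ f) :
    ∃ (ν : Measure X) (_ : IsFiniteMeasure ν), ν.Regular ∧
      ∀ f : D, φ f = ∫ x, (f : C(X, ℝ)) x ∂ν := by
  obtain ⟨g, hg, hg_nonneg⟩ := riesz_extension (PointedCone.positive ℝ C(X, ℝ)) ⟨D, φ⟩ hφ
    fun y => ⟨⟨‖y‖ • 1, D.smul_mem _ hone⟩, fun x => by
      simpa using neg_le_iff_add_nonneg'.1 (neg_le_of_abs_le (y.norm_coe_le_norm x))⟩
  let Γ : CompactlySupportedContinuousMap X ℝ →ₚ[ℝ] ℝ := PositiveLinearMap.mk₀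
    { toFun := fun f => g f.toContinuousMap
      map_add' := fun f h => g.map_add f.toContinuousMap h.toContinuousMap
      map_smul' := fun c f => g.map_smul c f.toContinuousMap }
    fun f hf => hg_nonneg _ fun x => hf x
  refine ⟨RealRMK.rieszMeasure Γ, inferInstance, inferInstance, fun f => ?_⟩
  exact ((RealRMK.integral_rieszMeasure Γ ⟨f, HasCompactSupport.of_compactSpace _⟩).trans
    (hg f)).symm

theorem exists_measure_of_nonneg (hone : 1 ∈ V) (hstar : ∀ f ∈ V, star f ∈ V)
    (Λ : C(X, ℂ) →ₗ[ℂ] ℂ) (hΛ : ∀ f ∈ V, 0 ≤ f → 0 ≤ Λ f) :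
    ∃ (ν : Measure X) (_ : IsFiniteMeasure ν), ν.Regular ∧
      ∀ f ∈ V, Λ f = cintegral (ofMeasure ν) f := by
  let ofReal : C(X, ℝ) →ₗ[ℝ] C(X, ℂ) := (Complex.ofRealCLM.compLeftContinuous ℝ X).toLinearMap
  have hofReal_one : ofReal 1 = 1 := by
    ext
    simp [ofReal]
  obtain ⟨ν, hfin, hreg, hν⟩ := exists_measure_of_nonneg_real
    (D := (V.restrictScalars ℝ).comap ofReal) (Submodule.mem_comap.2 (hofReal_one ▸ hone))
    ((Complex.reLm ∘ₗ Λ.restrictScalars ℝ ∘ₗ ofReal).domRestrict _) fun f hf =>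
      (Complex.nonneg_iff.1 (hΛ _ f.2 fun x => Complex.zero_le_real.2 (hf x))).1
  have hvar : IsFiniteMeasure (ofMeasure ν).variation := by
    rwa [variation_ofMeasure]
  refine ⟨ν, hfin, hreg, fun f hf => linearMap_apply_eq_of_eq_of_isSelfAdjoint
    (Λ' := (cintegralCLM (ofMeasure ν)).toLinearMap) hstar (fun f hf hsa => ?_) hf⟩
  obtain ⟨r, rfl⟩ : ∃ r : C(X, ℝ), ofReal r = f := by
    refine ⟨⟨fun x => (f x).re, by fun_prop⟩, ?_⟩
    ext x
    exact Complex.conj_eq_iff_re.1 (DFunLike.congr_fun hsa x)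
  calc Λ (ofReal r) = ((Λ (ofReal r)).re : ℂ) :=
        Complex.ext rfl (im_eq_zero_of_isSelfAdjoint hone hΛ hf hsa)
    _ = ((∫ x, r x ∂ν : ℝ) : ℂ) := congrArg _ (hν ⟨r, hf⟩)
    _ = ∫ x, ofReal r x ∂ν := integral_ofReal.symm
    _ = cintegral (ofMeasure ν) (ofReal r) :=
        (cintegral_ofMeasure (integrable_continuousMap ν _)).symm

end Extension

section Transform

variable {X : Type*} [TopologicalSpace X] {W : Type*} {e : W → C(X, ℂ)} {ℓ : W → ℂ}

/-- The positive definite functions on `W` relative to a family of continuous functions indexed by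
`W`. -/
def PosDefOf (e : W → C(X, ℂ)) : Set (W → ℂ) :=
  {ℓ | ∀ (n : ℕ) (c : Fin n → ℂ) (T : Fin n → W),
    (∀ x, 0 ≤ ∑ i, c i * e (T i) x) → 0 ≤ ∑ i, c i * ℓ (T i)}

lemma linearCombination_eq_sum_fin {V : Type*} [AddCommGroup V] [Module ℂ V] (g : W → V)
    (c : W →₀ ℂ) :
    Finsupp.linearCombination ℂ g c = ∑ i : Fin c.support.card,
      c (c.support.equivFin.symm i) • g (c.support.equivFin.symm i) := by
  rw [Finsupp.linearCombination_apply, Finsupp.sum, ← Finset.sum_coe_sort,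
    ← Equiv.sum_comp c.support.equivFin.symm]

lemma PosDefOf.linearCombination_nonneg (hℓ : ℓ ∈ PosDefOf e) (c : W →₀ ℂ)
    (hc : 0 ≤ Finsupp.linearCombination ℂ e c) : 0 ≤ Finsupp.linearCombination ℂ ℓ c := by
  rw [linearCombination_eq_sum_fin] at hc ⊢
  exact hℓ _ _ _ fun x => by simpa using hc x

lemma PosDefOf.exists_linearMap (hℓ : ℓ ∈ PosDefOf e) :
    ∃ Λ : C(X, ℂ) →ₗ[ℂ] ℂ, (∀ w, Λ (e w) = ℓ w) ∧
      ∀ f ∈ Submodule.span ℂ (range e), 0 ≤ f → 0 ≤ Λ f := by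
  have hker : Finsupp.linearCombination ℂ ℓ ∈
      (LinearMap.ker (Finsupp.linearCombination ℂ e)).dualAnnihilator := by
    rw [Submodule.mem_dualAnnihilator]
    intro c hc
    rw [LinearMap.mem_ker] at hc
    have hneg := PosDefOf.linearCombination_nonneg hℓ (-c) (by rw [map_neg, hc, neg_zero])
    rw [map_neg, neg_nonneg] at hneg
    exact hneg.antisymm (PosDefOf.linearCombination_nonneg hℓ c hc.ge)
  rw [← LinearMap.range_dualMap_eq_dualAnnihilator_ker] at hker
  obtain ⟨Λ, hΛ⟩ := hker
  refine ⟨Λ, fun w => by simpa using DFunLike.congr_fun hΛ (Finsupp.single w 1), ?_⟩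
  intro f hf hf_nonneg
  rw [← Finsupp.range_linearCombination] at hf
  obtain ⟨c, rfl⟩ := hf
  exact (PosDefOf.linearCombination_nonneg hℓ c hf_nonneg).trans_eq (DFunLike.congr_fun hΛ c).symm

variable [CompactSpace X] [T2Space X] [MeasurableSpace X] [BorelSpace X]

/-- The integral transform `μ ↦ (w ↦ ∫ e w dμ)` of regular complex measures. -/
def transform (e : W → C(X, ℂ)) {C : ℝ} (he : ∀ w, ‖e w‖ ≤ C) :
    RegMeas X →L[ℂ] lp (fun _ : W => ℂ) ∞ :=
  LinearMap.mkContinuous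
    { toFun := fun μ => ⟨fun w => cintegral (μ : ComplexMeasure X) (e w),
        memℓp_infty ⟨_, forall_mem_range.2 fun w =>
          norm_cintegral_le _ fun x => ((e w).norm_coe_le_norm x).trans (he w)⟩⟩
      map_add' := fun μ ν => by
        ext w
        exact VectorMeasure.integral_add_vectorMeasure (integrable_continuousMap _ (e w))
          (integrable_continuousMap _ (e w))
      map_smul' := fun c μ => by
        ext w
        exact cintegral_smul_measure (integrable_continuousMap _ (e w)) c }
    (max C 0) fun μ => lp.norm_le_of_forall_le (by positivity) fun w =>
      norm_cintegral_le _ fun x =>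
        ((e w).norm_coe_le_norm x).trans ((he w).trans (le_max_left _ _))

variable {C : ℝ} (he : ∀ w, ‖e w‖ ≤ C)

@[simp]
lemma transform_apply (μ : RegMeas X) (w : W) :
    transform e he μ w = cintegral (μ : ComplexMeasure X) (e w) := rfl

lemma transform_injective (hdense : Dense (Submodule.span ℂ (range e) : Set C(X, ℂ))) :
    Function.Injective (transform e he) := by
  rw [injective_iff_map_eq_zero]
  intro μ hμ
  refine Subtype.ext (eq_zero_of_cintegral_eq_zero_of_dense hdense _ ?_)
  rintro _ ⟨w, rfl⟩
  rw [← transform_apply he, hμ, lp.coeFn_zero, Pi.zero_apply]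

lemma transform_mem_posDefOf {μ : RegMeas X} (hμ : μ ∈ PosMeas X) :
    ⇑(transform e he μ) ∈ PosDefOf e := by
  intro n c T hT
  obtain ⟨ν, hν, hμν⟩ := exists_eq_ofMeasure hμ
  have hsum : ∑ i, c i * transform e he μ (T i) =
      cintegralCLM (μ : ComplexMeasure X) (∑ i, c i • e (T i)) := by
    simp [map_sum]
  rw [hsum, cintegralCLM_apply, hμν, cintegral_ofMeasure (integrable_continuousMap ν _)]
  exact integral_nonneg fun x => by simpa using hT x

lemma exists_transform_eq (hone : 1 ∈ Submodule.span ℂ (range e))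
    (hstar : ∀ f ∈ Submodule.span ℂ (range e), star f ∈ Submodule.span ℂ (range e))
    (hℓ : ℓ ∈ PosDefOf e) : ∃ μ ∈ PosMeas X, ⇑(transform e he μ) = ℓ := by
  obtain ⟨Λ, hΛ, hΛ_nonneg⟩ := PosDefOf.exists_linearMap hℓ
  obtain ⟨ν, hfin, hreg, hν⟩ := exists_measure_of_nonneg hone hstar Λ hΛ_nonneg
  refine ⟨⟨ofMeasure ν, ofMeasure_mem_RegMeas ν⟩, fun s hs => ?_, funext fun w => ?_⟩
  · rw [ofMeasure_apply ν hs]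
    exact Complex.zero_le_real.2 measureReal_nonneg
  · rw [transform_apply, ← hΛ w]
    exact (hν _ (Submodule.subset_span ⟨w, rfl⟩)).symm

theorem bijOn_transform (hdense : Dense (Submodule.span ℂ (range e) : Set C(X, ℂ)))
    (hone : 1 ∈ Submodule.span ℂ (range e))
    (hstar : ∀ f ∈ Submodule.span ℂ (range e), star f ∈ Submodule.span ℂ (range e)) :
    BijOn (fun μ => ⇑(transform e he μ)) (PosMeas X) (PosDefOf e) :=
  ⟨fun _ => transform_mem_posDefOf he,
    fun _ _ _ _ h => transform_injective he hdense (lp.ext h),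
    fun _ => exists_transform_eq he hone hstar⟩

end Transform

/-! ### Linear differential equations and matrix groups -/

section Calculus

lemma eq_of_hasDerivAt_zero_off_finite {F : Type*} [NormedAddCommGroup F] [NormedSpace ℝ F]
    [CompleteSpace F] {f : ℝ → F} {a b : ℝ} (hab : a ≤ b) (hcont : ContinuousOn f (Icc a b))
    (hderiv : ∀ᶠ t in Filter.cofinite, t ∈ Ioo a b → HasDerivAt f 0 t) : f a = f b := by
  have hint := integral_eq_of_hasDerivAt_off_countable_of_le f (fun _ => 0) hab
    (Filter.eventually_cofinite.1 hderiv).countable hcont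
    (fun t ht => not_not.1 ht.2 ht.1) (by simp)
  rw [intervalIntegral.integral_zero] at hint
  exact (sub_eq_zero.1 hint.symm).symm

lemma eq_left_of_hasDerivWithinAt_zero {F : Type*} [NormedAddCommGroup F] [NormedSpace ℝ F]
    {f : ℝ → F} {a b : ℝ} (hf : ∀ t ∈ Icc a b, HasDerivWithinAt f 0 (Icc a b) t) :
    ∀ t ∈ Icc a b, f t = f a :=
  constant_of_has_deriv_right_zero (fun t ht => (hf t ht).continuousWithinAt)
    fun t ht => (hf t (Ico_subset_Icc_self ht)).mono_of_mem_nhdsWithin (Icc_mem_nhdsGE_of_mem ht)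

lemma exists_hasDerivWithinAt_linear {𝔸 : Type*} [NormedRing 𝔸] [NormedAlgebra ℝ 𝔸]
    [CompleteSpace 𝔸] {α : ℝ → 𝔸} {a b K : ℝ} (hab : a ≤ b) (hα : ContinuousOn α (Icc a b))
    (hK : ∀ t ∈ Icc a b, ‖α t‖ ≤ K) (hlen : K * (‖(1 : 𝔸)‖ + 1) * (b - a) ≤ 1) :
    ∃ h : ℝ → 𝔸, h a = 1 ∧ ∀ t ∈ Icc a b, HasDerivWithinAt h (α t * h t) (Icc a b) t := by
  lift K to NNReal using (norm_nonneg _).trans (hK a ⟨le_rfl, hab⟩)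
  have hpl : IsPicardLindelof (fun t x => α t * x) (tmin := a) (tmax := b) ⟨a, le_rfl, hab⟩ (1 : 𝔸)
      1 0 (K * (‖(1 : 𝔸)‖₊ + 1)) K := by
    constructor
    · intro t ht
      refine LipschitzOnWith.of_dist_le_mul fun x _ y _ => ?_
      rw [dist_eq_norm, dist_eq_norm, ← mul_sub]
      exact (norm_mul_le _ _).trans (by gcongr; exact hK t ht)
    · exact fun x _ => hα.mul continuousOn_const
    · intro t ht x hx
      have hx_norm : ‖x‖ ≤ ‖(1 : 𝔸)‖ + 1 := by
        simpa [add_comm] using norm_le_norm_add_const_of_dist_le (Metric.mem_closedBall.1 hx)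
      push_cast
      exact norm_mul_le_of_le (hK t ht) hx_norm
    · simpa [sub_nonneg.2 hab] using hlen
  simpa using hpl.exists_eq_forall_mem_Icc_hasDerivWithinAt₀

lemma exists_nhds_linear_solution {𝔸 : Type*} [NormedRing 𝔸] [NormedAlgebra ℝ 𝔸]
    [CompleteSpace 𝔸] {α : ℝ → 𝔸} {s : Set ℝ} (hα : ContinuousOn α s) {τ : ℝ} (hτ : τ ∈ s) :
    ∃ V ∈ nhds τ, ∀ a b, a ≤ b → Icc a b ⊆ V ∩ s →
      ∃ h : ℝ → 𝔸, h a = 1 ∧ ∀ t ∈ Icc a b, HasDerivWithinAt h (α t * h t) (Icc a b) t := by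
  set K := ‖α τ‖ + 1
  set R := K * (‖(1 : 𝔸)‖ + 1)
  have hR : 0 < R := by positivity
  obtain ⟨U, hU, hUK⟩ := mem_nhdsWithin_iff_exists_mem_nhds_inter.1
    ((hα τ hτ).norm.eventually_lt_const (lt_add_one _) : ∀ᶠ t in nhdsWithin τ s, ‖α t‖ < K)
  refine ⟨U ∩ Metric.closedBall τ (1 / (2 * R)),
    Filter.inter_mem hU (Metric.closedBall_mem_nhds τ (by positivity)), fun a b hab hV => ?_⟩
  refine exists_hasDerivWithinAt_linear hab (hα.mono fun t ht => (hV ht).2)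
    (fun t ht => (hUK ⟨(hV ht).1.1, (hV ht).2⟩).le) ?_
  have hlen : b - a ≤ 1 / (2 * R) + 1 / (2 * R) :=
    (le_abs_self _).trans (dist_triangle_right b a τ |>.trans
      (add_le_add (hV ⟨hab, le_rfl⟩).1.2 (hV ⟨le_rfl, hab⟩).1.2))
  calc R * (b - a) ≤ R * (1 / (2 * R) + 1 / (2 * R)) := by gcongr
    _ = 1 := by field_simp; norm_num

variable {N : ℕ} {X : ℝ → Matrix (Fin N) (Fin N) ℂ} {X' : Matrix (Fin N) (Fin N) ℂ}

lemma hasDerivWithinAt_matrix {s : Set ℝ} {t : ℝ} :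
    HasDerivWithinAt X X' s t ↔ ∀ k l, HasDerivWithinAt (fun τ => X τ k l) (X' k l) s t := by
  refine ⟨fun h k l => ?_, fun h => ?_⟩
  · have hentry := (Matrix.entryLinearMap ℝ ℂ k l).toContinuousLinearMap.hasFDerivAt (x := X t)
    exact hentry.comp_hasDerivWithinAt t h
  · exact hasDerivWithinAt_pi.2 fun k => hasDerivWithinAt_pi.2 fun l => h k l

lemma hasDerivAt_matrix {t : ℝ} :
    HasDerivAt X X' t ↔ ∀ k l, HasDerivAt (fun τ => X τ k l) (X' k l) t := by
  simp only [← hasDerivWithinAt_univ (f := fun τ => X τ _ _)]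
  exact hasDerivWithinAt_univ.symm.trans hasDerivWithinAt_matrix

lemma continuousOn_matrix {α : Type*} [TopologicalSpace α] {X : α → Matrix (Fin N) (Fin N) ℂ}
    {s : Set α} : ContinuousOn X s ↔ ∀ k l, ContinuousOn (fun a => X a k l) s :=
  continuousOn_pi.trans (forall_congr' fun _ => continuousOn_pi)

lemma hasDerivAt_exp_smul_zero (X : Matrix (Fin N) (Fin N) ℂ) :
    HasDerivAt (fun t : ℝ => NormedSpace.exp (t • X)) X 0 :=
  (hasDerivAt_exp_smul_const X (0 : ℝ)).congr_deriv (by simp)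

end Calculus

section MatrixGroups

variable {N : ℕ} {G : Subgroup (Matrix.unitaryGroup (Fin N) ℂ)}

@[simp]
lemma mat_one : mat (1 : G) = 1 := rfl

lemma mat_mul (g h : G) : mat (g * h) = mat g * mat h := rfl

lemma mat_inv (g : G) : mat g⁻¹ = star (mat g) := rfl

lemma mat_injective : Function.Injective (mat : G → Matrix (Fin N) (Fin N) ℂ) :=
  Subtype.val_injective.comp Subtype.val_injective

lemma star_mat_mul_mat (g : G) : star (mat g) * mat g = 1 :=
  Matrix.mem_unitaryGroup_iff'.1 g.1.2

lemma mat_mul_star_mat (g : G) : mat g * star (mat g) = 1 :=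
  Matrix.mem_unitaryGroup_iff.1 g.1.2

lemma star_eq_neg_of_mem_lieAlg {X : Matrix (Fin N) (Fin N) ℂ} (hX : X ∈ lieAlg G) :
    star X = -X := by
  have hderiv : HasDerivAt (fun t : ℝ => star (NormedSpace.exp (t • X)) * NormedSpace.exp (t • X))
      (star X + X) 0 :=
    ((hasDerivAt_exp_smul_zero X).star.mul (hasDerivAt_exp_smul_zero X)).congr_deriv (by simp)
  have hconst : (fun t : ℝ => star (NormedSpace.exp (t • X)) * NormedSpace.exp (t • X)) =
      fun _ => 1 := by
    ext1 t
    obtain ⟨g, hg⟩ := hX t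
    rw [← hg, star_mat_mul_mat]
  rw [hconst] at hderiv
  exact eq_neg_of_add_eq_zero_left (hderiv.unique (hasDerivAt_const _ _))

lemma neg_mem_lieAlg {X : Matrix (Fin N) (Fin N) ℂ} (hX : X ∈ lieAlg G) : -X ∈ lieAlg G :=
  fun t => by simpa using hX (-t)

lemma hasDerivWithinAt_det_fin_two {X : ℝ → Matrix (Fin 2) (Fin 2) ℂ}
    {α : Matrix (Fin 2) (Fin 2) ℂ} {s : Set ℝ} {t : ℝ} (hX : HasDerivWithinAt X (α * X t) s t) :
    HasDerivWithinAt (fun τ => (X τ).det) (α.trace * (X t).det) s t := by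
  have h := hasDerivWithinAt_matrix.1 hX
  simp only [Matrix.det_fin_two]
  refine (((h 0 0).mul (h 1 1)).sub ((h 0 1).mul (h 1 0))).congr_deriv ?_
  simp only [Matrix.mul_apply, Fin.sum_univ_two, Matrix.trace_fin_two]
  ring

lemma trace_eq_zero_of_mem_lieAlg_SU {X : Matrix (Fin 2) (Fin 2) ℂ} (hX : X ∈ lieAlg (SU 2)) :
    X.trace = 0 := by
  have hderiv : HasDerivWithinAt (fun t : ℝ => (NormedSpace.exp (t • X)).det) X.trace univ 0 :=
    (hasDerivWithinAt_det_fin_two (α := X)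
      (hasDerivWithinAt_univ.2 ((hasDerivAt_exp_smul_zero X).congr_deriv (by simp)))).congr_deriv
      (by simp)
  have hconst : (fun t : ℝ => (NormedSpace.exp (t • X)).det) = fun _ => 1 := by
    ext1 t
    obtain ⟨g, hg⟩ := hX t
    rw [← hg]
    exact g.2
  rw [hconst] at hderiv
  exact (hasDerivWithinAt_univ.1 hderiv).unique (hasDerivAt_const _ _)

variable {α h : ℝ → Matrix (Fin N) (Fin N) ℂ} {a b : ℝ}

lemma mem_unitaryGroup_of_hasDerivWithinAt (hα : ∀ t ∈ Icc a b, star (α t) = -α t) (ha : h a = 1)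
    (hh : ∀ t ∈ Icc a b, HasDerivWithinAt h (α t * h t) (Icc a b) t) :
    ∀ t ∈ Icc a b, h t ∈ Matrix.unitaryGroup (Fin N) ℂ := by
  have hderiv : ∀ t ∈ Icc a b, HasDerivWithinAt (fun τ => star (h τ) * h τ) 0 (Icc a b) t := by
    intro t ht
    refine ((hh t ht).star.mul (hh t ht)).congr_deriv ?_
    rw [star_mul, hα t ht, mul_neg, neg_mul, mul_assoc, neg_add_cancel]
  exact fun t ht => Matrix.mem_unitaryGroup_iff'.2
    ((eq_left_of_hasDerivWithinAt_zero hderiv t ht).trans (by simp [ha]))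

lemma IsU1OrSU2.exists_mat_eq_of_hasDerivWithinAt (hG : IsU1OrSU2 G)
    (hα : ∀ t ∈ Icc a b, α t ∈ lieAlg G) (ha : h a = 1)
    (hh : ∀ t ∈ Icc a b, HasDerivWithinAt h (α t * h t) (Icc a b) t) :
    ∀ t ∈ Icc a b, ∃ g : G, mat g = h t := by
  have hU := mem_unitaryGroup_of_hasDerivWithinAt
    (fun t ht => star_eq_neg_of_mem_lieAlg (hα t ht)) ha hh
  cases hG with
  | u1 => exact fun t ht => ⟨⟨⟨h t, hU t ht⟩, trivial⟩, rfl⟩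
  | su2 =>
    have hdet := eq_left_of_hasDerivWithinAt_zero (f := fun t => (h t).det) fun t ht =>
      (hasDerivWithinAt_det_fin_two (hh t ht)).congr_deriv
        (by rw [trace_eq_zero_of_mem_lieAlg_SU (hα t ht), zero_mul])
    exact fun t ht => ⟨⟨⟨h t, hU t ht⟩, (hdet t ht).trans (by rw [ha, Matrix.det_one])⟩, rfl⟩

end MatrixGroups

/-! ### Piecewise curves and horizontal lifts -/

section Curves

variable {N : ℕ} {G : Subgroup (Matrix.unitaryGroup (Fin N) ℂ)}
  {E : Type*} [NormedAddCommGroup E] [NormedSpace ℝ E]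
  {M : Type*} [TopologicalSpace M] [ChartedSpace E M] {P : Type*} {B : PrincipalBundle G E M P}
  {c c' : ℝ → M} {a b t : ℝ}

/-- The velocity of a curve. -/
def velocity (c : ℝ → M) (t : ℝ) : TangentSpace 𝓘(ℝ, E) (c t) :=
  mfderiv 𝓘(ℝ, ℝ) 𝓘(ℝ, E) c t (1 : ℝ)

lemma hasDerivAt_comp_velocity {f : M → ℂ} (hf : MDifferentiableAt 𝓘(ℝ, E) 𝓘(ℝ, ℂ) f (c t))
    (hc : MDifferentiableAt 𝓘(ℝ, ℝ) 𝓘(ℝ, E) c t) :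
    HasDerivAt (fun s => f (c s)) (mfderiv 𝓘(ℝ, E) 𝓘(ℝ, ℂ) f (c t) (velocity c t)) t := by
  have h : HasFDerivAt (fun s => f (c s)) (show ℝ →L[ℝ] ℂ from
      (mfderiv 𝓘(ℝ, E) 𝓘(ℝ, ℂ) f (c t)).comp (mfderiv 𝓘(ℝ, ℝ) 𝓘(ℝ, E) c t)) t :=
    (hf.hasMFDerivAt.comp t hc.hasMFDerivAt).hasFDerivAt
  exact h.hasDerivAt

lemma velocity_comp_affine {ε d : ℝ} (hc : MDifferentiableAt 𝓘(ℝ, ℝ) 𝓘(ℝ, E) c (ε * t + d)) :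
    velocity (E := E) (fun t => c (ε * t + d)) t = ε • velocity c (ε * t + d) := by
  have hφ : HasDerivAt (fun t => ε * t + d) ε t := by
    simpa using ((hasDerivAt_id t).const_mul ε).add_const d
  have hcomp := (hc.hasMFDerivAt.comp t hφ.hasFDerivAt.hasMFDerivAt).mfderiv
  calc mfderiv 𝓘(ℝ, ℝ) 𝓘(ℝ, E) (c ∘ fun t => ε * t + d) t (1 : ℝ)
      = mfderiv 𝓘(ℝ, ℝ) 𝓘(ℝ, E) c (ε * t + d)
          (ContinuousLinearMap.toSpanSingleton ℝ ε (1 : ℝ)) := DFunLike.congr_fun hcomp _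
    _ = mfderiv 𝓘(ℝ, ℝ) 𝓘(ℝ, E) c (ε * t + d) (ε • (1 : ℝ)) := by simp
    _ = ε • velocity c (ε * t + d) := map_smul _ ε (1 : ℝ)

variable (E) in
/-- A continuous curve on `[a, b]` that is differentiable off a finite set. -/
structure IsPiecewiseDiff (c : ℝ → M) (a b : ℝ) : Prop where
  continuousOn : ContinuousOn c (Icc a b)
  mdifferentiableAt : ∀ᶠ t in Filter.cofinite, t ∈ Ioo a b →
    MDifferentiableAt 𝓘(ℝ, ℝ) 𝓘(ℝ, E) c t

lemma eventually_mem_dom (hc : ContinuousOn c (Icc a b)) (ht : t ∈ Ioo a b) {i : B.ι}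
    (hi : c t ∈ B.dom i) : ∀ᶠ s in nhds t, s ∈ Icc a b ∧ c s ∈ B.dom i := by
  have hIcc : Icc a b ∈ nhds t := Icc_mem_nhds ht.1 ht.2
  exact Filter.inter_mem hIcc
    ((hc.continuousAt hIcc).preimage_mem_nhds ((B.isOpen_dom i).mem_nhds hi))

lemma inter_preimage_dom_mem_nhdsWithin {s : Set ℝ} (hc : ContinuousWithinAt c s t) {i : B.ι}
    (hi : c t ∈ B.dom i) : s ∩ c ⁻¹' B.dom i ∈ nhdsWithin t s :=
  Filter.inter_mem self_mem_nhdsWithin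
    (hc.preimage_mem_nhdsWithin ((B.isOpen_dom i).mem_nhds hi))

lemma mdifferentiableAt_trans (B : PrincipalBundle G E M P) {i j : B.ι} {x : M} (hi : x ∈ B.dom i)
    (hj : x ∈ B.dom j) (k l : Fin N) :
    MDifferentiableAt 𝓘(ℝ, E) 𝓘(ℝ, ℂ) (fun y => mat (B.trans i j y) k l) x :=
  ((B.smooth_trans i j k l).contMDiffAt
    (((B.isOpen_dom i).inter (B.isOpen_dom j)).mem_nhds ⟨hi, hj⟩)).mdifferentiableAt (by simp)

lemma exists_proj_eq_coord_eq (B : PrincipalBundle G E M P) {x : M} {i : B.ι} (hi : x ∈ B.dom i)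
    (g : G) : ∃ p, B.proj p = x ∧ B.coord i p = g := by
  obtain ⟨q, rfl⟩ := B.proj_surjective x
  refine ⟨B.act q ((B.coord i q)⁻¹ * g), B.proj_act _ _, ?_⟩
  rw [B.coord_act i q _ hi, mul_inv_cancel_left]

lemma eq_of_coord_eq {p q : P} {i : B.ι} (hp : B.proj p ∈ B.dom i) (h : B.proj p = B.proj q)
    (hcoord : B.coord i p = B.coord i q) : p = q := by
  obtain ⟨g, rfl, -⟩ := B.existsUnique_act p q h
  rw [B.coord_act i p g hp, left_eq_mul] at hcoord
  rw [hcoord, B.act_one]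

lemma eq_one_of_act_eq_self {p : P} {g : G} (h : B.act p g = p) : g = 1 :=
  (B.existsUnique_act p p rfl).unique h (B.act_one p)

lemma mat_coord_act {i : B.ι} {p : P} (hp : B.proj p ∈ B.dom i) (g : G) :
    mat (B.coord i (B.act p g)) = mat (B.coord i p) * mat g := by
  rw [B.coord_act i p g hp, mat_mul]

lemma mat_coord_eq {i j : B.ι} {p : P} (hi : B.proj p ∈ B.dom i) (hj : B.proj p ∈ B.dom j) :
    mat (B.coord i p) = mat (B.trans i j (B.proj p)) * mat (B.coord j p) := by
  rw [← mat_mul, ← B.coord_eq i j p hi hj]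

lemma mat_eq_star_mul_of_act_eq {p q : P} {g : G} {i : B.ι} (hg : B.act p g = q)
    (hi : B.proj p ∈ B.dom i) : mat g = star (mat (B.coord i p)) * mat (B.coord i q) := by
  rw [← hg, mat_coord_act hi, ← mul_assoc, star_mat_mul_mat, one_mul]

end Curves

section Lifts

variable {N : ℕ} {G : Subgroup (Matrix.unitaryGroup (Fin N) ℂ)}
  {E : Type*} [NormedAddCommGroup E] [NormedSpace ℝ E]
  {M : Type*} [TopologicalSpace M] [ChartedSpace E M] [IsManifold 𝓘(ℝ, E) ω M] {P : Type*}
  {B : PrincipalBundle G E M P} {A : Connection B} {c c' : ℝ → M} {u u' : ℝ → P} {a b t : ℝ}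

/-- At the time `t`, the curve `u` satisfies the equation `h' = - Aᵢ(c') h` of parallel transport
along `c`, where `h` is its coordinate in the `i`-th trivialization. -/
def LiftEqAt (A : Connection B) (c : ℝ → M) (u : ℝ → P) (i : B.ι) (t : ℝ) : Prop :=
  HasDerivAt (fun s => mat (B.coord i (u s)))
    (-(A.form i (c t) (velocity c t) * mat (B.coord i (u t)))) t

/-- `u` is a horizontal lift of the curve `c` on the interval `[a, b]`. -/
structure IsLiftOn (A : Connection B) (c : ℝ → M) (a b : ℝ) (u : ℝ → P) : Prop where
  proj_eq : ∀ t ∈ Icc a b, B.proj (u t) = c t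
  continuousOn_coord : ∀ i, ContinuousOn (fun t => mat (B.coord i (u t)))
    (Icc a b ∩ c ⁻¹' B.dom i)
  liftEqAt : ∀ᶠ t in Filter.cofinite, t ∈ Ioo a b → ∀ i, c t ∈ B.dom i → LiftEqAt A c u i t

lemma isLiftOn_iff_isHorizontalLift {x₀ : M} {γ : PLoop E x₀} :
    IsLiftOn A γ.toFun γ.a γ.b u ↔ IsHorizontalLift A γ u := by
  constructor
  · rintro ⟨hproj, hcont, heq⟩
    refine ⟨hproj, fun i => continuousOn_matrix.1 (hcont i), _, Filter.eventually_cofinite.1 heq,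
      fun t ht i hi => hasDerivAt_matrix.1 (not_not.1 ht.2 ht.1 i hi)⟩
  · rintro ⟨hproj, hcont, S, hS, heq⟩
    refine ⟨hproj, fun i => continuousOn_matrix.2 (hcont i), ?_⟩
    filter_upwards [hS.eventually_cofinite_notMem] with t htS ht i hi
    exact hasDerivAt_matrix.2 (heq t ⟨ht, htS⟩ i hi)

lemma LiftEqAt.congr {i : B.ι} (h : LiftEqAt A c u i t) (hc : c =ᶠ[nhds t] c')
    (hu : u =ᶠ[nhds t] u') : LiftEqAt A c' u' i t := by
  have hform : A.form i (c t) (velocity c t) = A.form i (c' t) (velocity c' t) := by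
    have hct : c t = c' t := hc.eq_of_nhds
    unfold velocity
    rw [hc.mfderiv_eq]
    congr!
  unfold LiftEqAt at h ⊢
  rw [hform, hu.eq_of_nhds] at h
  exact h.congr_of_eventuallyEq (hu.symm.mono fun s hs => by simp only [hs])

lemma IsLiftOn.refl {p : P} (hp : B.proj p = c a) : IsLiftOn A c a a fun _ => p where
  proj_eq t ht := by rw [Icc_self, mem_singleton_iff] at ht; rw [ht, hp]
  continuousOn_coord _ := continuousOn_const
  liftEqAt := .of_forall fun t ht => absurd ht (by simp)

lemma IsLiftOn.act (hc : ContinuousOn c (Icc a b)) (hu : IsLiftOn A c a b u) (g : G) :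
    IsLiftOn A c a b fun t => B.act (u t) g where
  proj_eq t ht := by rw [B.proj_act, hu.proj_eq t ht]
  continuousOn_coord i := ((hu.continuousOn_coord i).mul continuousOn_const).congr fun t ht =>
    mat_coord_act ((hu.proj_eq t ht.1).symm ▸ ht.2) g
  liftEqAt := by
    filter_upwards [hu.liftEqAt] with t heq ht i hi
    have hcoord : ∀ᶠ s in nhds t, mat (B.coord i (B.act (u s) g)) = mat (B.coord i (u s)) * mat g :=
      (eventually_mem_dom hc ht hi).mono fun s hs =>
        mat_coord_act ((hu.proj_eq s hs.1).symm ▸ hs.2) g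
    refine (((heq ht i hi).mul_const (mat g)).congr_of_eventuallyEq hcoord).congr_deriv ?_
    rw [hcoord.self_of_nhds, neg_mul, mul_assoc]

lemma IsLiftOn.congr (hu : IsLiftOn A c a b u) (hc : EqOn c c' (Icc a b))
    (huu : EqOn u u' (Icc a b)) : IsLiftOn A c' a b u' where
  proj_eq t ht := by rw [← huu ht, ← hc ht, hu.proj_eq t ht]
  continuousOn_coord i := by
    rw [← hc.inter_preimage_eq]
    exact (hu.continuousOn_coord i).congr fun t ht => by simp only [huu ht.1]
  liftEqAt := by
    filter_upwards [hu.liftEqAt] with t heq ht i hi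
    have hIcc : Icc a b ∈ nhds t := Icc_mem_nhds ht.1 ht.2
    rw [← hc (mem_of_mem_nhds hIcc)] at hi
    exact (heq ht i hi).congr (hc.eventuallyEq_of_mem hIcc) (huu.eventuallyEq_of_mem hIcc)

lemma IsLiftOn.union {m : ℝ} (ham : a ≤ m) (hmb : m ≤ b) (h : IsLiftOn A c a m u)
    (h' : IsLiftOn A c m b u) : IsLiftOn A c a b u where
  proj_eq t ht := (Icc_union_Icc_eq_Icc ham hmb ▸ ht).elim (h.proj_eq t) (h'.proj_eq t)
  continuousOn_coord i := by
    rw [← Icc_union_Icc_eq_Icc ham hmb, union_inter_distrib_right]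
    have hpiece : ∀ p q t, c t ∈ B.dom i → IsLiftOn A c p q u → ContinuousWithinAt
        (fun t => mat (B.coord i (u t))) (Icc p q ∩ c ⁻¹' B.dom i) t := by
      intro p q t hi hpq
      by_cases ht : t ∈ Icc p q
      · exact hpq.continuousOn_coord i t ⟨ht, hi⟩
      · exact continuousWithinAt_of_notMem_closure fun hcl =>
          ht (closure_minimal inter_subset_left isClosed_Icc hcl)
    intro t ht
    have hi : c t ∈ B.dom i := ht.elim And.right And.right
    exact (hpiece a m t hi h).union (hpiece m b t hi h')
  liftEqAt := by
    filter_upwards [h.liftEqAt, h'.liftEqAt, (finite_singleton m).eventually_cofinite_notMem]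
      with t heq heq' htm ht
    rcases lt_or_gt_of_ne htm with hlt | hgt
    · exact heq ⟨ht.1, hlt⟩
    · exact heq' ⟨hgt, ht.2⟩

lemma IsLiftOn.exists_concat {m : ℝ} (ham : a ≤ m) (hmb : m ≤ b) (h : IsLiftOn A c a m u)
    (h' : IsLiftOn A c m b u') (huu : u m = u' m) :
    ∃ w, IsLiftOn A c a b w ∧ w a = u a ∧ w b = u' b := by
  have hright : EqOn u' (fun t => if t ≤ m then u t else u' t) (Icc m b) := fun t ht => by
    rcases eq_or_lt_of_le ht.1 with rfl | hlt
    · simp [huu]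
    · exact (if_neg hlt.not_ge).symm
  exact ⟨_, (h.congr (eqOn_refl _ _) fun t ht => (if_pos ht.2).symm).union ham hmb
    (h'.congr (eqOn_refl _ _) hright), if_pos ham, (hright ⟨hmb, le_rfl⟩).symm⟩

lemma IsLiftOn.comp_affine {a' b' ε d : ℝ} (hc : IsPiecewiseDiff E c a b)
    (hu : IsLiftOn A c a b u) (hε : ε ≠ 0)
    (hmaps : MapsTo (fun t => ε * t + d) (Icc a' b') (Icc a b)) :
    IsLiftOn A (fun t => c (ε * t + d)) a' b' fun t => u (ε * t + d) where
  proj_eq t ht := hu.proj_eq _ (hmaps ht)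
  continuousOn_coord i :=
    (hu.continuousOn_coord i).comp (by fun_prop) fun t ht => ⟨hmaps ht.1, ht.2⟩
  liftEqAt := by
    have hmaps_Ioo : MapsTo (fun t => ε * t + d) (Ioo a' b') (Ioo a b) := by
      have h := (affineHomeomorph ε d hε).isOpenMap.mapsTo_interior hmaps
      rwa [interior_Icc, interior_Icc] at h
    have hinj : Function.Injective fun t : ℝ => ε * t + d := (affineHomeomorph ε d hε).injective
    filter_upwards [hinj.tendsto_cofinite.eventually hu.liftEqAt,
      hinj.tendsto_cofinite.eventually hc.mdifferentiableAt]
      with t heq hdiff ht i hi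
    have hφ : HasDerivAt (fun t => ε * t + d) ε t := by
      simpa using ((hasDerivAt_id t).const_mul ε).add_const d
    have hderiv := heq (hmaps_Ioo ht) i hi
    unfold LiftEqAt at hderiv
    refine (hderiv.scomp t hφ).congr_deriv ?_
    rw [velocity_comp_affine (hdiff (hmaps_Ioo ht)), map_smul, smul_mul_assoc, smul_neg]

end Lifts

section Transport

variable {N : ℕ} {G : Subgroup (Matrix.unitaryGroup (Fin N) ℂ)}
  {E : Type*} [NormedAddCommGroup E] [NormedSpace ℝ E]
  {M : Type*} [TopologicalSpace M] [ChartedSpace E M] [IsManifold 𝓘(ℝ, E) ω M] {P : Type*}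
  {B : PrincipalBundle G E M P} {A : Connection B} {c : ℝ → M} {u v : ℝ → P} {a b s t : ℝ}

lemma LiftEqAt.change {i j : B.ι} (h : LiftEqAt A c u i t) (hi : c t ∈ B.dom i)
    (hj : c t ∈ B.dom j) (hc : MDifferentiableAt 𝓘(ℝ, ℝ) 𝓘(ℝ, E) c t)
    (hu : ∀ᶠ s in nhds t, B.proj (u s) = c s) : LiftEqAt A c u j t := by
  set T := mat (B.trans j i (c t)) with hT
  set dT : Matrix (Fin N) (Fin N) ℂ := Matrix.of fun k l =>
    (mfderiv 𝓘(ℝ, E) 𝓘(ℝ, ℂ) (fun y => mat (B.trans j i y) k l) (c t) (velocity c t) : ℂ)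
  have hderiv : HasDerivAt (fun s => mat (B.trans j i (c s))) dT t :=
    hasDerivAt_matrix.2 fun k l => hasDerivAt_comp_velocity (mdifferentiableAt_trans B hj hi k l) hc
  have hcoord : ∀ᶠ s in nhds t, mat (B.coord j (u s)) =
      mat (B.trans j i (c s)) * mat (B.coord i (u s)) := by
    filter_upwards [hu, hc.continuousAt.preimage_mem_nhds ((B.isOpen_dom i).mem_nhds hi),
      hc.continuousAt.preimage_mem_nhds ((B.isOpen_dom j).mem_nhds hj)] with s hs hsi hsj
    rw [mat_coord_eq (i := j) (j := i) (hs ▸ hsj) (hs ▸ hsi), hs]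
  have hgauge : dT = T * A.form i (c t) (velocity c t) - A.form j (c t) (velocity c t) * T := by
    have hTT : T * mat (B.trans j i (c t))⁻¹ = 1 := mat_mul_star_mat _
    rw [A.form_trans j i (c t) hj hi, mul_add, ← mul_assoc, ← mul_assoc, hTT, one_mul, ← mul_assoc,
      hTT, one_mul, add_sub_cancel_left]
  unfold LiftEqAt at h ⊢
  refine ((hderiv.mul h).congr_of_eventuallyEq hcoord).congr_deriv ?_
  rw [hcoord.self_of_nhds, ← hT, hgauge]
  noncomm_ring

/-! ### Uniqueness of horizontal lifts -/

lemma LiftEqAt.hasDerivAt_star_mul {i : B.ι} (hi : c t ∈ B.dom i) (hu : LiftEqAt A c u i t)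
    (hv : LiftEqAt A c v i t) :
    HasDerivAt (fun s => star (mat (B.coord i (u s))) * mat (B.coord i (v s))) 0 t := by
  refine (HasDerivAt.mul (HasDerivAt.star hu) hv).congr_deriv ?_
  rw [star_neg, star_mul, star_eq_neg_of_mem_lieAlg (A.form_mem i _ hi _)]
  noncomm_ring

/-- Two lifts differ by a curve in `G`, which is constant because in a trivialization its
derivative vanishes. -/
lemma IsLiftOn.eq_right_of_eq_left (hab : a ≤ b) (hc : ContinuousOn c (Icc a b))
    (hu : IsLiftOn A c a b u) (hv : IsLiftOn A c a b v) (huv : u a = v a) : u b = v b := by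
  have hfibre : ∀ t : Icc a b, ∃ g : G, B.act (u t) g = v t := fun t =>
    (B.existsUnique_act _ _ (by rw [hu.proj_eq t t.2, hv.proj_eq t t.2])).exists
  choose g hg using hfibre
  set g' : ℝ → Matrix (Fin N) (Fin N) ℂ := IccExtend hab fun t => mat (g t)
  have hg' : ∀ t ∈ Icc a b, ∀ i, c t ∈ B.dom i →
      g' t = star (mat (B.coord i (u t))) * mat (B.coord i (v t)) := fun t ht i hi => by
    rw [← mat_eq_star_mul_of_act_eq (hg ⟨t, ht⟩) ((hu.proj_eq t ht).symm ▸ hi)]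
    exact IccExtend_of_mem hab _ ht
  have hcont : ContinuousOn g' (Icc a b) := fun t ht => by
    obtain ⟨i, hi⟩ := B.cover (c t)
    have hnhds := inter_preimage_dom_mem_nhdsWithin (hc t ht) hi
    exact ((((hu.continuousOn_coord i).star.mul (hv.continuousOn_coord i)).congr
      fun s hs => hg' s hs.1 i hs.2) t ⟨ht, hi⟩).mono_of_mem_nhdsWithin hnhds
  have hderiv : ∀ᶠ t in Filter.cofinite, t ∈ Ioo a b → HasDerivAt g' 0 t := by
    filter_upwards [hu.liftEqAt, hv.liftEqAt] with t hut hvt ht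
    obtain ⟨i, hi⟩ := B.cover (c t)
    exact ((hut ht i hi).hasDerivAt_star_mul hi (hvt ht i hi)).congr_of_eventuallyEq
      ((eventually_mem_dom hc ht hi).mono fun s hs => hg' s hs.1 i hs.2)
  have hconst : mat (g ⟨a, left_mem_Icc.2 hab⟩) = mat (g ⟨b, right_mem_Icc.2 hab⟩) :=
    (IccExtend_left hab _).symm.trans ((eq_of_hasDerivAt_zero_off_finite hab hcont hderiv).trans
      (IccExtend_right hab _))
  have hone : g ⟨a, left_mem_Icc.2 hab⟩ = 1 := eq_one_of_act_eq_self ((hg _).trans huv.symm)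
  rw [← hg ⟨b, right_mem_Icc.2 hab⟩, ← mat_injective hconst, hone, B.act_one]

/-! ### Existence of horizontal lifts -/

lemma continuousOn_form_velocity (A : Connection B) (hst : s < t)
    (hc : ContMDiffOn 𝓘(ℝ, ℝ) 𝓘(ℝ, E) 1 c (Icc s t)) (i : B.ι) :
    ContinuousOn (fun τ => A.form i (c τ)
      (mfderivWithin 𝓘(ℝ, ℝ) 𝓘(ℝ, E) c (Icc s t) τ (1 : ℝ))) (Icc s t ∩ c ⁻¹' B.dom i) := by
  have : IsManifold 𝓘(ℝ, E) 1 M := IsManifold.of_le (n := ω) le_top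
  have htangent := hc.continuousOn_tangentMapWithin le_rfl (uniqueDiffOn_Icc hst).uniqueMDiffOn
  have hunit : Continuous fun τ : ℝ => (⟨τ, (1 : ℝ)⟩ : TangentBundle 𝓘(ℝ, ℝ) ℝ) :=
    (tangentBundleModelSpaceHomeomorph 𝓘(ℝ, ℝ)).symm.continuous.comp
      (by fun_prop : Continuous fun τ : ℝ => ((τ, 1) : ModelProd ℝ ℝ))
  exact continuousOn_matrix.2 fun k l => (A.smooth_form i k l).continuousOn.comp
    (htangent.comp hunit.continuousOn fun τ (hτ : τ ∈ Icc s t ∩ c ⁻¹' B.dom i) => hτ.1)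
    fun τ hτ => hτ.2

lemma IsLiftOn.of_coord {i : B.ι} (hc : ContinuousOn c (Icc a b))
    (hdiff : ∀ t ∈ Ioo a b, MDifferentiableAt 𝓘(ℝ, ℝ) 𝓘(ℝ, E) c t)
    (hdom : ∀ t ∈ Icc a b, c t ∈ B.dom i) (hproj : ∀ t ∈ Icc a b, B.proj (u t) = c t)
    (hcont : ContinuousOn (fun t => mat (B.coord i (u t))) (Icc a b))
    (heq : ∀ t ∈ Ioo a b, LiftEqAt A c u i t) : IsLiftOn A c a b u where
  proj_eq := hproj
  continuousOn_coord j := by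
    have htrans : ContinuousOn (fun t => mat (B.trans j i (c t))) (Icc a b ∩ c ⁻¹' B.dom j) :=
      continuousOn_matrix.2 fun k l => (B.smooth_trans j i k l).continuousOn.comp
        (hc.mono inter_subset_left) fun t ht => ⟨ht.2, hdom t ht.1⟩
    refine (htrans.mul (hcont.mono inter_subset_left)).congr fun t ht => ?_
    have hproj_t := hproj t ht.1
    rw [mat_coord_eq (i := j) (j := i) (hproj_t ▸ ht.2) (hproj_t ▸ hdom t ht.1), hproj_t]
    rfl
  liftEqAt := .of_forall fun t ht j hj =>
    (heq t ht).change (hdom t (Ioo_subset_Icc_self ht)) hj (hdiff t ht)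
      (Filter.eventually_of_mem (Icc_mem_nhds ht.1 ht.2) hproj)

lemma exists_lift_of_solution (hG : IsU1OrSU2 G) (hab : a ≤ b) (hc : ContinuousOn c (Icc a b))
    (hdiff : ∀ t ∈ Ioo a b, MDifferentiableAt 𝓘(ℝ, ℝ) 𝓘(ℝ, E) c t) {i : B.ι}
    (hdom : ∀ t ∈ Icc a b, c t ∈ B.dom i) {α h : ℝ → Matrix (Fin N) (Fin N) ℂ}
    (hα : ∀ t ∈ Icc a b, α t ∈ lieAlg G)
    (hα_velocity : ∀ t ∈ Ioo a b, α t = A.form i (c t) (velocity c t)) (ha : h a = 1)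
    (hh : ∀ t ∈ Icc a b, HasDerivWithinAt h (-α t * h t) (Icc a b) t) {p : P}
    (hp : B.proj p = c a) : ∃ u, IsLiftOn A c a b u ∧ u a = p := by
  have hpoint : ∀ t : Icc a b, ∃ q, B.proj q = c t ∧
      mat (B.coord i q) = h t * mat (B.coord i p) := fun t => by
    obtain ⟨g, hg⟩ := hG.exists_mat_eq_of_hasDerivWithinAt
      (fun t ht => neg_mem_lieAlg (hα t ht)) ha hh t t.2
    obtain ⟨q, hq, hcoord⟩ := exists_proj_eq_coord_eq B (hdom t t.2) (g * B.coord i p)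
    exact ⟨q, hq, by rw [hcoord, mat_mul, hg]⟩
  choose u' hproj' hcoord' using hpoint
  set u : ℝ → P := IccExtend hab u'
  have hproj : ∀ t ∈ Icc a b, B.proj (u t) = c t := fun t ht => by
    rw [show u t = u' ⟨t, ht⟩ from IccExtend_of_mem hab _ ht, hproj']
  have hcoord : ∀ t ∈ Icc a b, mat (B.coord i (u t)) = h t * mat (B.coord i p) := fun t ht => by
    rw [show u t = u' ⟨t, ht⟩ from IccExtend_of_mem hab _ ht, hcoord']
  have hcont : ContinuousOn (fun t => mat (B.coord i (u t))) (Icc a b) :=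
    (ContinuousOn.mul (fun t ht => (hh t ht).continuousWithinAt) continuousOn_const).congr hcoord
  refine ⟨u, .of_coord hc hdiff hdom hproj hcont fun t ht => ?_, ?_⟩
  · have hIcc : Icc a b ∈ nhds t := Icc_mem_nhds ht.1 ht.2
    refine ((((hh t (mem_of_mem_nhds hIcc)).hasDerivAt hIcc).mul_const
      (mat (B.coord i p))).congr_of_eventuallyEq
        (Filter.eventually_of_mem hIcc hcoord)).congr_deriv ?_
    rw [hcoord t (mem_of_mem_nhds hIcc), hα_velocity t ht, neg_mul, neg_mul, mul_assoc]
  · have ha_mem : a ∈ Icc a b := ⟨le_rfl, hab⟩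
    refine eq_of_coord_eq (i := i) ((hproj a ha_mem).symm ▸ hdom a ha_mem)
      ((hproj a ha_mem).trans hp.symm) (mat_injective ?_)
    rw [hcoord a ha_mem, ha, one_mul]

lemma exists_nhds_lift (hG : IsU1OrSU2 G) (A : Connection B) (hst : s < t)
    (hc : ContMDiffOn 𝓘(ℝ, ℝ) 𝓘(ℝ, E) 1 c (Icc s t)) {τ : ℝ} (hτ : τ ∈ Icc s t) :
    ∃ V ∈ nhds τ, ∀ a b, a ≤ b → Icc a b ⊆ V ∩ Icc s t →
      ∀ p, B.proj p = c a → ∃ u, IsLiftOn A c a b u ∧ u a = p := by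
  obtain ⟨i, hi⟩ := B.cover (c τ)
  obtain ⟨U, hU, hUdom⟩ := mem_nhdsWithin_iff_exists_mem_nhds_inter.1
    (inter_preimage_dom_mem_nhdsWithin (hc.continuousOn τ hτ) hi)
  obtain ⟨V, hV, hsolve⟩ := exists_nhds_linear_solution
    (continuousOn_form_velocity A hst hc i).neg ⟨hτ, hi⟩
  refine ⟨U ∩ V, Filter.inter_mem hU hV, fun a b hab hsub p hp => ?_⟩
  have hmem : Icc a b ⊆ Icc s t ∩ c ⁻¹' B.dom i := fun σ hσ =>
    hUdom ⟨(hsub hσ).1.1, (hsub hσ).2⟩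
  have hIcc : ∀ σ ∈ Ioo a b, Icc s t ∈ nhds σ := fun σ hσ =>
    Filter.mem_of_superset (Icc_mem_nhds hσ.1 hσ.2) fun ρ hρ => (hmem hρ).1
  obtain ⟨h, ha, hh⟩ := hsolve a b hab fun σ hσ => ⟨(hsub hσ).1.2, hmem hσ⟩
  refine exists_lift_of_solution hG hab (hc.continuousOn.mono fun σ hσ => (hmem hσ).1)
    (fun σ hσ => (hc.contMDiffAt (hIcc σ hσ)).mdifferentiableAt (by simp))
    (fun σ hσ => (hmem hσ).2) (fun σ hσ => A.form_mem i _ (hmem hσ).2 _)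
    (fun σ hσ => ?_) ha hh hp
  rw [velocity, mfderivWithin_of_mem_nhds (hIcc σ hσ)]

lemma exists_lift_of_contMDiffOn (hG : IsU1OrSU2 G) (A : Connection B) (hst : s ≤ t)
    (hc : ContMDiffOn 𝓘(ℝ, ℝ) 𝓘(ℝ, E) 1 c (Icc s t)) {p : P} (hp : B.proj p = c s) :
    ∃ u, IsLiftOn A c s t u ∧ u s = p := by
  rcases hst.eq_or_lt with rfl | hlt
  · exact ⟨_, .refl hp, rfl⟩
  choose V hV hlift using fun x : Icc s t => exists_nhds_lift hG A hlt hc x.2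
  obtain ⟨r, hr_zero, hr_mono, ⟨m, hr_last⟩, hr_sub⟩ := exists_monotone_Icc_subset_open_cover_Icc
    hst (c := fun x : Icc s t => Subtype.val ⁻¹' interior (V x))
    (fun x => isOpen_interior.preimage continuous_subtype_val)
    (fun x _ => mem_iUnion.2 ⟨x, mem_interior_iff_mem_nhds.2 (hV x)⟩)
  have hlift_upto : ∀ n : ℕ, ∃ u, IsLiftOn A c s (r n) u ∧ u s = p := by
    intro n
    induction n with
    | zero => rw [hr_zero]; exact ⟨_, .refl hp, rfl⟩
    | succ n ih =>
      obtain ⟨u, hu, hus⟩ := ih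
      obtain ⟨x, hx⟩ := hr_sub n
      have hle : (r n : ℝ) ≤ r (n + 1) := hr_mono n.le_succ
      have hsub : Icc (r n : ℝ) (r (n + 1)) ⊆ V x ∩ Icc s t := fun τ hτ =>
        have hτst : τ ∈ Icc s t := ⟨(r n).2.1.trans hτ.1, hτ.2.trans (r (n + 1)).2.2⟩
        ⟨interior_subset (hx (a := ⟨τ, hτst⟩) hτ), hτst⟩
      obtain ⟨v, hv, hvr⟩ := hlift x _ _ hle hsub (u (r n)) (hu.proj_eq _ ⟨(r n).2.1, le_rfl⟩)
      obtain ⟨w, hw, hws, -⟩ := hu.exists_concat (r n).2.1 hle hv hvr.symm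
      exact ⟨w, hw, hws.trans hus⟩
  exact hr_last m le_rfl ▸ hlift_upto m

end Transport

/-! ### Operations on loops and their holonomy -/

section Loops

variable {E : Type*} [NormedAddCommGroup E] [NormedSpace ℝ E]
  {M : Type*} [TopologicalSpace M] [ChartedSpace E M] {c c' : ℝ → M} {a b : ℝ} {x₀ : M}

variable (E) in
/-- A curve that is analytic on each interval of a subdivision of `[a, b]`, as in the definition of
`PLoop`. -/
def IsPiecewiseAnalytic (c : ℝ → M) (a b : ℝ) : Prop :=
  ∃ (n : ℕ) (t : ℕ → ℝ), Monotone t ∧ t 0 = a ∧ t n = b ∧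
    ∀ i < n, ContMDiffOn 𝓘(ℝ, ℝ) 𝓘(ℝ, E) ω c (Icc (t i) (t (i + 1)))

lemma IsPiecewiseAnalytic.refl (c : ℝ → M) (a : ℝ) : IsPiecewiseAnalytic E c a a :=
  ⟨0, fun _ => a, monotone_const, rfl, rfl, by simp⟩

lemma IsPiecewiseAnalytic.congr (hc : IsPiecewiseAnalytic E c a b) (h : EqOn c' c (Icc a b)) :
    IsPiecewiseAnalytic E c' a b := by
  obtain ⟨n, t, hmono, rfl, rfl, hpiece⟩ := hc
  exact ⟨n, t, hmono, rfl, rfl, fun i hi => (hpiece i hi).congr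
    (h.mono (Icc_subset_Icc (hmono i.zero_le) (hmono hi)))⟩

lemma IsPiecewiseAnalytic.concat {m : ℝ} (h : IsPiecewiseAnalytic E c a m)
    (h' : IsPiecewiseAnalytic E c m b) : IsPiecewiseAnalytic E c a b := by
  obtain ⟨n, t, ht_mono, rfl, htn, ht⟩ := h
  obtain ⟨k, r, hr_mono, hr0, rfl, hr⟩ := h'
  set s : ℕ → ℝ := fun i => if i ≤ n then t i else r (i - n)
  have hs_left : ∀ i ≤ n, s i = t i := fun i hi => if_pos hi
  have hs_right : ∀ i, s (n + i) = r i := fun i => by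
    rcases i.eq_zero_or_pos with rfl | hi
    · rw [add_zero, hs_left n le_rfl, htn, hr0]
    · simp only [s, add_tsub_cancel_left, if_neg (show ¬ n + i ≤ n by omega)]
  refine ⟨n + k, s, monotone_nat_of_le_succ fun i => ?_, hs_left 0 n.zero_le, hs_right k,
    fun i hi => ?_⟩
  all_goals rcases lt_or_ge i n with hin | hin
  · rw [hs_left i hin.le, hs_left (i + 1) hin]
    exact ht_mono i.le_succ
  · obtain ⟨j, rfl⟩ := Nat.exists_eq_add_of_le hin
    rw [add_assoc, hs_right, hs_right]
    exact hr_mono j.le_succ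
  · rw [hs_left i hin.le, hs_left (i + 1) hin]
    exact ht i hin
  · obtain ⟨j, rfl⟩ := Nat.exists_eq_add_of_le hin
    rw [add_assoc, hs_right, hs_right]
    exact hr j (by omega)

lemma IsPiecewiseAnalytic.comp_add_const (hc : IsPiecewiseAnalytic E c a b) (d : ℝ) :
    IsPiecewiseAnalytic E (fun t => c (t + d)) (a - d) (b - d) := by
  obtain ⟨n, t, hmono, rfl, rfl, hpiece⟩ := hc
  have hshift : ContMDiff 𝓘(ℝ, ℝ) 𝓘(ℝ, ℝ) ω fun t : ℝ => t + d :=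
    contMDiff_iff_contDiff.2 (by fun_prop)
  refine ⟨n, fun i => t i - d, fun i j hij => sub_le_sub_right (hmono hij) d, rfl, rfl,
    fun i hi => (hpiece i hi).comp hshift.contMDiffOn fun τ hτ => ?_⟩
  exact ⟨sub_le_iff_le_add.1 hτ.1, le_sub_iff_add_le.1 hτ.2⟩

lemma IsPiecewiseAnalytic.comp_const_sub (hc : IsPiecewiseAnalytic E c a b) (d : ℝ) :
    IsPiecewiseAnalytic E (fun t => c (d - t)) (d - b) (d - a) := by
  obtain ⟨n, t, hmono, rfl, rfl, hpiece⟩ := hc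
  have hreflect : ContMDiff 𝓘(ℝ, ℝ) 𝓘(ℝ, ℝ) ω fun t : ℝ => d - t :=
    contMDiff_iff_contDiff.2 (by fun_prop)
  refine ⟨n, fun i => d - t (n - i),
    fun i j hij => sub_le_sub_left (hmono (Nat.sub_le_sub_left hij n)) d, by simp, by simp,
    fun i hi => ?_⟩
  have hsucc := hpiece (n - (i + 1)) (by omega)
  rw [show n - (i + 1) + 1 = n - i by omega] at hsucc
  exact hsucc.comp hreflect.contMDiffOn fun τ hτ => ⟨le_sub_comm.1 hτ.2, sub_le_comm.1 hτ.1⟩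

lemma IsPiecewiseAnalytic.eventually_mdifferentiableAt (hc : IsPiecewiseAnalytic E c a b) :
    ∀ᶠ τ in Filter.cofinite, τ ∈ Ioo a b → MDifferentiableAt 𝓘(ℝ, ℝ) 𝓘(ℝ, E) c τ := by
  obtain ⟨n, t, hmono, rfl, rfl, hpiece⟩ := hc
  filter_upwards [((finite_Iic n).image t).eventually_cofinite_notMem] with τ hτ_ne hτ
  have hcover := hmono.biUnion_Ico_Ioc_map_succ 0 n ▸ Ioo_subset_Ioc_self hτ
  obtain ⟨i, hi, hτi⟩ := mem_iUnion₂.1 hcover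
  have hτ_lt : τ < t (i + 1) := hτi.2.lt_of_ne fun h => hτ_ne ⟨i + 1, hi.2, h.symm⟩
  exact ((hpiece i hi.2).contMDiffAt (Icc_mem_nhds hτi.1 hτ_lt)).mdifferentiableAt (by simp)

lemma PLoop.isPiecewiseDiff (γ : PLoop E x₀) : IsPiecewiseDiff E γ.toFun γ.a γ.b :=
  ⟨γ.continuousOn, IsPiecewiseAnalytic.eventually_mdifferentiableAt γ.piecewise_analytic⟩

/-- The constant loop. -/
def PLoop.const (x₀ : M) : PLoop E x₀ where
  toFun _ := x₀
  a := 0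
  b := 0
  le := le_rfl
  continuousOn := continuousOn_const
  piecewise_analytic := IsPiecewiseAnalytic.refl _ 0
  source := rfl
  target := rfl

/-- The loop run through in the opposite direction. -/
def PLoop.inv (γ : PLoop E x₀) : PLoop E x₀ where
  toFun t := γ.toFun (γ.a + γ.b - t)
  a := γ.a
  b := γ.b
  le := γ.le
  continuousOn := γ.continuousOn.comp (by fun_prop) fun t ht =>
    ⟨by linarith [ht.2], by linarith [ht.1]⟩
  piecewise_analytic := by
    have h := IsPiecewiseAnalytic.comp_const_sub γ.piecewise_analytic (γ.a + γ.b)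
    rwa [add_sub_cancel_right, add_sub_cancel_left] at h
  source := by rw [add_sub_cancel_left, γ.target]
  target := by rw [add_sub_cancel_right, γ.source]

/-- The underlying function of the concatenation of two loops: first `γ`, then `δ`. -/
def PLoop.concatFun (γ δ : PLoop E x₀) (t : ℝ) : M :=
  if t ≤ γ.b then γ.toFun t else δ.toFun (t + (δ.a - γ.b))

lemma PLoop.concatFun_eqOn_left (γ δ : PLoop E x₀) :
    EqOn (γ.concatFun δ) γ.toFun (Iic γ.b) := fun _ ht => if_pos ht

lemma PLoop.concatFun_eqOn_right (γ δ : PLoop E x₀) :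
    EqOn (γ.concatFun δ) (fun t => δ.toFun (t + (δ.a - γ.b))) (Ici γ.b) := by
  intro t ht
  rcases eq_or_lt_of_le (mem_Ici.1 ht) with rfl | hlt
  · simp only [γ.concatFun_eqOn_left δ self_mem_Iic, γ.target, add_sub_cancel, δ.source]
  · exact if_neg hlt.not_ge

/-- The concatenation of two loops. -/
def PLoop.mul (γ δ : PLoop E x₀) : PLoop E x₀ where
  toFun := γ.concatFun δ
  a := γ.a
  b := γ.b + (δ.b - δ.a)
  le := by linarith [γ.le, δ.le]
  continuousOn := by
    have hleft := γ.continuousOn.congr fun t ht => γ.concatFun_eqOn_left δ ht.2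
    have hshift : ContinuousOn (fun t => δ.toFun (t + (δ.a - γ.b)))
        (Icc γ.b (γ.b + (δ.b - δ.a))) :=
      δ.continuousOn.comp (by fun_prop) fun t ht => ⟨by linarith [ht.1], by linarith [ht.2]⟩
    have hright := hshift.congr fun t ht => γ.concatFun_eqOn_right δ ht.1
    rw [← Icc_union_Icc_eq_Icc γ.le (by linarith [δ.le])]
    exact hleft.union_of_isClosed hright isClosed_Icc isClosed_Icc
  piecewise_analytic := by
    have hshift := IsPiecewiseAnalytic.comp_add_const δ.piecewise_analytic (δ.a - γ.b)
    rw [sub_sub_cancel, show δ.b - (δ.a - γ.b) = γ.b + (δ.b - δ.a) by ring] at hshift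
    exact (IsPiecewiseAnalytic.congr γ.piecewise_analytic
      fun t ht => γ.concatFun_eqOn_left δ ht.2).concat
        (hshift.congr fun t ht => γ.concatFun_eqOn_right δ ht.1)
  source := by rw [γ.concatFun_eqOn_left δ γ.le, γ.source]
  target := by
    simp only [γ.concatFun_eqOn_right δ (show γ.b ≤ γ.b + (δ.b - δ.a) by linarith [δ.le])]
    rw [show γ.b + (δ.b - δ.a) + (δ.a - γ.b) = δ.b by ring, δ.target]

end Loops

section Holonomy

variable {N : ℕ} {G : Subgroup (Matrix.unitaryGroup (Fin N) ℂ)}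
  {E : Type*} [NormedAddCommGroup E] [NormedSpace ℝ E]
  {M : Type*} [TopologicalSpace M] [ChartedSpace E M] [IsManifold 𝓘(ℝ, E) ω M] {P : Type*}
  {B : PrincipalBundle G E M P}

lemma IsPiecewiseAnalytic.exists_lift (hG : IsU1OrSU2 G) (A : Connection B) {c : ℝ → M} {a b : ℝ}
    (hc : IsPiecewiseAnalytic E c a b) {p : P} (hp : B.proj p = c a) :
    ∃ u, IsLiftOn A c a b u ∧ u a = p := by
  obtain ⟨n, t, hmono, rfl, rfl, hpiece⟩ := hc
  induction n with
  | zero => exact ⟨_, .refl hp, rfl⟩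
  | succ n ih =>
    obtain ⟨u, hu, hu_left⟩ := ih fun i hi => hpiece i (hi.trans n.lt_succ_self)
    have hle : t 0 ≤ t n := hmono n.zero_le
    obtain ⟨v, hv, hv_left⟩ := exists_lift_of_contMDiffOn hG A (hmono n.le_succ)
      ((hpiece n n.lt_succ_self).of_le (by simp)) (hu.proj_eq _ (right_mem_Icc.2 hle))
    obtain ⟨w, hw, hw_left, -⟩ := hu.exists_concat hle (hmono n.le_succ) hv hv_left.symm
    exact ⟨w, hw, hw_left.trans hu_left⟩

lemma IsLiftOn.proj_right_eq {A : Connection B} {x₀ : M} {γ : PLoop E x₀} {u : ℝ → P}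
    (hu : IsLiftOn A γ.toFun γ.a γ.b u) : B.proj (u γ.b) = x₀ := by
  rw [hu.proj_eq _ (right_mem_Icc.2 γ.le), γ.target]

lemma holonomy_spec (hG : IsU1OrSU2 G) (A : Connection B) (u₀ : P) (γ : PLoop E (B.proj u₀)) :
    ∃ u, IsLiftOn A γ.toFun γ.a γ.b u ∧ u γ.a = u₀ ∧ u₀ = B.act (u γ.b) (holonomy A u₀ γ) := by
  obtain ⟨u, hu, hu_left⟩ :=
    IsPiecewiseAnalytic.exists_lift hG A γ.piecewise_analytic γ.source.symm
  obtain ⟨g, hg, -⟩ := B.existsUnique_act (u γ.b) u₀ hu.proj_right_eq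
  obtain ⟨v, hv, hv_ends⟩ := Classical.epsilon_spec (p := fun g : G => ∃ u : ℝ → P,
    IsHorizontalLift A γ u ∧ u γ.a = u₀ ∧ u₀ = B.act (u γ.b) g)
    ⟨g, u, isLiftOn_iff_isHorizontalLift.1 hu, hu_left, hg.symm⟩
  exact ⟨v, isLiftOn_iff_isHorizontalLift.2 hv, hv_ends⟩

lemma holonomy_eq (hG : IsU1OrSU2 G) {A : Connection B} {u₀ : P} {γ : PLoop E (B.proj u₀)}
    {u : ℝ → P} (hu : IsLiftOn A γ.toFun γ.a γ.b u) (hu_left : u γ.a = u₀) {g : G}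
    (hg : u₀ = B.act (u γ.b) g) : holonomy A u₀ γ = g := by
  obtain ⟨v, hv, hv_left, hv_right⟩ := holonomy_spec hG A u₀ γ
  have huv : v γ.b = u γ.b :=
    hv.eq_right_of_eq_left γ.le γ.continuousOn hu (hv_left.trans hu_left.symm)
  rw [huv] at hv_right
  exact (B.existsUnique_act (u γ.b) u₀ hu.proj_right_eq).unique hv_right.symm hg.symm

lemma holonomy_const (hG : IsU1OrSU2 G) (A : Connection B) (u₀ : P) :
    holonomy A u₀ (PLoop.const (E := E) (B.proj u₀)) = 1 :=
  holonomy_eq hG (γ := PLoop.const _) (u := fun _ => u₀)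
    (IsLiftOn.refl (c := fun _ => B.proj u₀) (a := 0) rfl) rfl (B.act_one u₀).symm

lemma holonomy_inv (hG : IsU1OrSU2 G) (A : Connection B) (u₀ : P) (γ : PLoop E (B.proj u₀)) :
    holonomy A u₀ γ.inv = (holonomy A u₀ γ)⁻¹ := by
  obtain ⟨u, hu, hu_left, hu_right⟩ := holonomy_spec hG A u₀ γ
  have hreflect := (hu.act γ.continuousOn (holonomy A u₀ γ)).comp_affine
    (a' := γ.a) (b' := γ.b) (ε := -1) (d := γ.a + γ.b) γ.isPiecewiseDiff (by norm_num)
    fun t ht => ⟨by linarith [ht.2], by linarith [ht.1]⟩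
  simp only [neg_one_mul, neg_add_eq_sub] at hreflect
  refine holonomy_eq hG hreflect ?_ ?_
  · rw [show γ.inv.a = γ.a from rfl, add_sub_cancel_left, ← hu_right]
  · rw [show γ.inv.b = γ.b from rfl, add_sub_cancel_right, hu_left, ← B.act_mul, mul_inv_cancel,
      B.act_one]

lemma holonomy_mul (hG : IsU1OrSU2 G) (A : Connection B) (u₀ : P) (γ δ : PLoop E (B.proj u₀)) :
    holonomy A u₀ (γ.mul δ) = holonomy A u₀ γ * holonomy A u₀ δ := by
  obtain ⟨u, hu, hu_left, hu_right⟩ := holonomy_spec hG A u₀ γ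
  obtain ⟨v, hv, hv_left, hv_right⟩ := holonomy_spec hG A u₀ δ
  set g := holonomy A u₀ γ
  have hle : γ.b ≤ γ.b + (δ.b - δ.a) := by linarith [δ.le]
  have hshift := (hv.act δ.continuousOn g⁻¹).comp_affine
    (a' := γ.b) (b' := γ.b + (δ.b - δ.a)) (ε := 1) (d := δ.a - γ.b) δ.isPiecewiseDiff one_ne_zero
    fun t ht => ⟨by linarith [ht.1], by linarith [ht.2]⟩
  simp only [one_mul] at hshift
  have hback : B.act u₀ g⁻¹ = u γ.b := by
    nth_rewrite 1 [hu_right]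
    rw [← B.act_mul, mul_inv_cancel, B.act_one]
  have hmatch : u γ.b = B.act (v (γ.b + (δ.a - γ.b))) g⁻¹ := by
    rw [add_sub_cancel, hv_left, hback]
  obtain ⟨w, hw, hw_left, hw_right⟩ :=
    (hu.congr (fun t ht => (γ.concatFun_eqOn_left δ ht.2).symm) (eqOn_refl u _)).exists_concat
      γ.le hle (hshift.congr (fun t ht => (γ.concatFun_eqOn_right δ ht.1).symm) (eqOn_refl _ _))
      hmatch
  refine holonomy_eq (γ := γ.mul δ) hG hw (hw_left.trans hu_left) ?_
  rw [show (γ.mul δ).b = γ.b + (δ.b - δ.a) from rfl, hw_right,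
    show γ.b + (δ.b - δ.a) + (δ.a - γ.b) = δ.b by ring, ← B.act_mul, inv_mul_cancel_left]
  exact hv_right

end Holonomy

/-! ### Sections of the associated line bundle -/

section OneDimensional

variable {E : Type*} [NormedAddCommGroup E] [NormedSpace ℝ E]
  {M : Type*} [TopologicalSpace M] [ChartedSpace E M]

variable (E) in
/-- The images of `K` under `C¹` functions defined near (parts of) `K` have Hausdorff dimension at
most one. This is the form in which one-dimensionality of the loops enters the transversality
argument `exists_forall_add_mul_ne_zero`. -/
def IsAtMostOneDim (K : Set M) : Prop :=
  ∀ (U : Set M) (φ : M → ℂ), IsOpen U → ContMDiffOn 𝓘(ℝ, E) 𝓘(ℝ, ℂ) 1 φ U →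
    dimH (φ '' (K ∩ U)) ≤ 1

lemma IsAtMostOneDim.iUnion {ι : Type*} [Countable ι] {K : ι → Set M}
    (hK : ∀ i, IsAtMostOneDim E (K i)) : IsAtMostOneDim E (⋃ i, K i) := by
  intro U φ hU hφ
  rw [iUnion_inter, image_iUnion, dimH_iUnion]
  exact iSup_le fun i => hK i U φ hU hφ

lemma IsAtMostOneDim.union {K K' : Set M} (hK : IsAtMostOneDim E K) (hK' : IsAtMostOneDim E K') :
    IsAtMostOneDim E (K ∪ K') := by
  intro U φ hU hφ
  rw [union_inter_distrib_right, image_union, dimH_union]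
  exact max_le (hK U φ hU hφ) (hK' U φ hU hφ)

lemma isAtMostOneDim_image_Icc {c : ℝ → M} {a b : ℝ}
    (hc : ContMDiffOn 𝓘(ℝ, ℝ) 𝓘(ℝ, E) 1 c (Icc a b)) : IsAtMostOneDim E (c '' Icc a b) := by
  intro U φ hU hφ
  rw [← image_inter_preimage, ← image_comp]
  refine (dimH_image_le_of_locally_lipschitzOn fun t ht => ?_).trans
    ((dimH_mono (subset_univ _)).trans Real.dimH_univ.le)
  have hφc : ContDiffWithinAt ℝ 1 (φ ∘ c) (Icc a b) t :=
    contMDiffWithinAt_iff_contDiffWithinAt.1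
      ((hφ.contMDiffAt (hU.mem_nhds ht.2)).comp_contMDiffWithinAt t (hc t ht.1))
  obtain ⟨C, V, hV, hlip⟩ := hφc.exists_lipschitzOnWith (convex_Icc a b)
  exact ⟨C, V, nhdsWithin_mono t inter_subset_left hV, hlip⟩

lemma IsPiecewiseAnalytic.isAtMostOneDim {c : ℝ → M} {a b : ℝ}
    (hc : IsPiecewiseAnalytic E c a b) : IsAtMostOneDim E (c '' Icc a b) := by
  obtain ⟨n, t, hmono, rfl, rfl, hpiece⟩ := hc
  induction n with
  | zero =>
    refine isAtMostOneDim_image_Icc ((contMDiffOn_const (c := c (t 0))).congr fun s hs => ?_)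
    rw [Icc_self] at hs
    rw [hs]
  | succ n ih =>
    rw [← Icc_union_Icc_eq_Icc (hmono n.zero_le) (hmono n.le_succ), image_union]
    exact (ih fun i hi => hpiece i (hi.trans n.lt_succ_self)).union
      (isAtMostOneDim_image_Icc ((hpiece n n.lt_succ_self).of_le le_top))

end OneDimensional

section LineSections

/-- The gauge group `U(1)`. -/
abbrev U1 : Subgroup (Matrix.unitaryGroup (Fin 1) ℂ) := ⊤

/-- The unit complex number given by an element of `U(1)`. -/
def phase (g : U1) : ℂ := mat g 0 0

lemma mat_eq_algebraMap_phase (g : U1) : mat g = algebraMap ℂ _ (phase g) := by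
  ext i j
  rw [Fin.fin_one_eq_zero i, Fin.fin_one_eq_zero j]
  simp [phase, Matrix.algebraMap_matrix_apply]

lemma phase_injective : Function.Injective phase := fun g h hgh =>
  mat_injective (by rw [mat_eq_algebraMap_phase, mat_eq_algebraMap_phase, hgh])

lemma phase_mul (g h : U1) : phase (g * h) = phase g * phase h := by
  simp [phase, mat_mul, Matrix.mul_apply]

lemma phase_inv (g : U1) : phase g⁻¹ = star (phase g) := by
  simp [phase, mat_inv]

lemma star_phase_mul_phase (g : U1) : star (phase g) * phase g = 1 := by
  rw [← phase_inv, ← phase_mul, inv_mul_cancel]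
  simp [phase, mat_one]

lemma norm_phase (g : U1) : ‖phase g‖ = 1 :=
  CStarRing.norm_of_mem_unitary (Unitary.mem_iff.2
    ⟨star_phase_mul_phase g, (mul_comm _ _).trans (star_phase_mul_phase g)⟩)

lemma phase_ne_zero (g : U1) : phase g ≠ 0 := norm_ne_zero_iff.1 (by simp [norm_phase])

lemma exists_phase_eq {w : ℂ} (hw : ‖w‖ = 1) : ∃ g, phase g = w := by
  refine ⟨⟨⟨algebraMap ℂ _ w, Matrix.mem_unitaryGroup_iff'.2 ?_⟩, trivial⟩, ?_⟩
  · rw [← algebraMap_star_comm, ← map_mul, RCLike.star_def, RCLike.conj_mul, hw]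
    simp
  · simp [phase, mat, Matrix.algebraMap_matrix_apply]

instance {𝕜 A : Type*} [NontriviallyNormedField 𝕜] [NormedRing A] [NormedAlgebra 𝕜 A]
    {n : WithTop ℕ∞} : ContMDiffMul 𝓘(𝕜, A) n A where
  contMDiff_mul := by
    rw [contMDiff_iff]
    refine ⟨continuous_mul, fun x y => ?_⟩
    simp only [mfld_simps, chartAt_self_eq]
    rw [contDiffOn_univ]
    exact contDiff_mul

variable {E : Type*} [NormedAddCommGroup E] [NormedSpace ℝ E]
  {M : Type*} [TopologicalSpace M] [ChartedSpace E M] {P : Type*}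

/-- The index of a local trivialization around `x`. -/
def PrincipalBundle.index {N : ℕ} {G : Subgroup (Matrix.unitaryGroup (Fin N) ℂ)}
    (B : PrincipalBundle G E M P) (x : M) : B.ι :=
  (B.cover x).choose

lemma PrincipalBundle.mem_dom_index {N : ℕ} {G : Subgroup (Matrix.unitaryGroup (Fin N) ℂ)}
    (B : PrincipalBundle G E M P) (x : M) : x ∈ B.dom (B.index x) :=
  (B.cover x).choose_spec

lemma PrincipalBundle.dom_mem_nhds {N : ℕ} {G : Subgroup (Matrix.unitaryGroup (Fin N) ℂ)}
    (B : PrincipalBundle G E M P) {i : B.ι} {x : M} (hi : x ∈ B.dom i) : B.dom i ∈ nhds x :=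
  (B.isOpen_dom i).mem_nhds hi

lemma PrincipalBundle.trans_mul_trans {N : ℕ} {G : Subgroup (Matrix.unitaryGroup (Fin N) ℂ)}
    (B : PrincipalBundle G E M P) {i j k : B.ι} {x : M} (hi : x ∈ B.dom i) (hj : x ∈ B.dom j)
    (hk : x ∈ B.dom k) : B.trans i j x * B.trans j k x = B.trans i k x := by
  obtain ⟨p, rfl⟩ := B.proj_surjective x
  refine mul_right_cancel (b := B.coord k p) ?_
  rw [mul_assoc, ← B.coord_eq j k p hj hk, ← B.coord_eq i j p hi hj, B.coord_eq i k p hi hk]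

variable {B : PrincipalBundle U1 E M P} {f g : B.ι → M → ℂ} {i j : B.ι} {x : M}

/-- A smooth section of the complex line bundle associated with a `U(1)`-bundle, given by its
components in the local trivializations. -/
structure IsSection (B : PrincipalBundle U1 E M P) (f : B.ι → M → ℂ) : Prop where
  smooth : ∀ i, ContMDiffOn 𝓘(ℝ, E) 𝓘(ℝ, ℂ) ∞ (f i) (B.dom i)
  trans : ∀ i j, ∀ x ∈ B.dom i, x ∈ B.dom j → f i x = phase (B.trans i j x) * f j x

lemma IsSection.contMDiffAt (hf : IsSection B f) (hi : x ∈ B.dom i) :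
    ContMDiffAt 𝓘(ℝ, E) 𝓘(ℝ, ℂ) ∞ (f i) x :=
  (hf.smooth i).contMDiffAt (B.dom_mem_nhds hi)

lemma IsSection.norm_eq (hf : IsSection B f) (hi : x ∈ B.dom i) (hj : x ∈ B.dom j) :
    ‖f i x‖ = ‖f j x‖ := by
  rw [hf.trans i j x hi hj, norm_mul, norm_phase, one_mul]

lemma IsSection.div_eq (hf : IsSection B f) (hg : IsSection B g) (hi : x ∈ B.dom i)
    (hj : x ∈ B.dom j) : f i x / g i x = f j x / g j x := by
  rw [hf.trans i j x hi hj, hg.trans i j x hi hj, mul_div_mul_left _ _ (phase_ne_zero _)]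

lemma isSection_zero (B : PrincipalBundle U1 E M P) : IsSection B 0 where
  smooth _ := contMDiffOn_const
  trans _ _ _ _ _ := (mul_zero _).symm

lemma IsSection.add (hf : IsSection B f) (hg : IsSection B g) : IsSection B (f + g) where
  smooth i := (hf.smooth i).add (hg.smooth i)
  trans i j x hi hj := by
    simp only [Pi.add_apply, hf.trans i j x hi hj, hg.trans i j x hi hj, mul_add]

lemma IsSection.mul_left (hf : IsSection B f) {r : M → ℂ}
    (hr : ContMDiff 𝓘(ℝ, E) 𝓘(ℝ, ℂ) ∞ r) : IsSection B fun i x => r x * f i x where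
  smooth i := hr.contMDiffOn.mul (hf.smooth i)
  trans i j x hi hj := by rw [hf.trans i j x hi hj, mul_left_comm]

lemma contMDiff_ofReal {ρ : M → ℝ} (hρ : ContMDiff 𝓘(ℝ, E) 𝓘(ℝ, ℝ) ∞ ρ) :
    ContMDiff 𝓘(ℝ, E) 𝓘(ℝ, ℂ) ∞ fun x => (ρ x : ℂ) :=
  Complex.ofRealCLM.contDiff.comp_contMDiff hρ

lemma isSection_bump {ρ : M → ℝ} (hρ : ContMDiff 𝓘(ℝ, E) 𝓘(ℝ, ℝ) ∞ ρ) {k : B.ι}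
    (hk : tsupport ρ ⊆ B.dom k) :
    IsSection B fun i x => (ρ x : ℂ) * phase (B.trans i k x) where
  smooth i x hx := by
    by_cases hxk : x ∈ tsupport ρ
    · have hopen := (B.isOpen_dom i).inter (B.isOpen_dom k)
      have htrans := (B.smooth_trans i k 0 0).contMDiffAt (hopen.mem_nhds ⟨hx, hk hxk⟩)
      exact ((contMDiff_ofReal hρ).contMDiffAt.mul htrans).contMDiffWithinAt
    · have hzero : (fun y => (ρ y : ℂ) * phase (B.trans i k y)) =ᶠ[nhds x] fun _ => 0 := by
        filter_upwards [(isClosed_tsupport ρ).isOpen_compl.mem_nhds hxk] with y hy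
        rw [image_eq_zero_of_notMem_tsupport hy, Complex.ofReal_zero, zero_mul]
      exact (contMDiffAt_const.congr_of_eventuallyEq hzero).contMDiffWithinAt
  trans i j x hi hj := by
    by_cases hxk : x ∈ tsupport ρ
    · rw [← B.trans_mul_trans hi hj (hk hxk), phase_mul, mul_left_comm]
    · rw [image_eq_zero_of_notMem_tsupport hxk, Complex.ofReal_zero, zero_mul, zero_mul, mul_zero]

lemma IsSection.isOpen_ne_zero (hg : IsSection B g) : IsOpen {x | g (B.index x) x ≠ 0} := by
  refine isOpen_iff_mem_nhds.2 fun x hx => ?_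
  have hi := B.mem_dom_index x
  filter_upwards [(hg.contMDiffAt hi).continuousAt.eventually_ne hx, B.dom_mem_nhds hi]
    with y hy hyi
  rwa [← norm_ne_zero_iff, hg.norm_eq (B.mem_dom_index y) hyi, norm_ne_zero_iff]

/-- Off the zeros of `g` the quotient `f / g` is a function; its values on `K` form a set of
dimension at most one, hence miss some complex number `-z`. -/
lemma IsSection.exists_forall_add_mul_ne_zero {K : Set M} (hK : IsAtMostOneDim E K)
    (hf : IsSection B f) (hg : IsSection B g) :
    ∃ z : ℂ, ∀ x ∈ K, ∀ i, x ∈ B.dom i → g i x ≠ 0 → f i x + z * g i x ≠ 0 := by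
  set φ : M → ℂ := fun x => f (B.index x) x / g (B.index x) x
  have hφ : ContMDiffOn 𝓘(ℝ, E) 𝓘(ℝ, ℂ) 1 φ {x | g (B.index x) x ≠ 0} := fun x hx => by
    have hi := B.mem_dom_index x
    have hquot : ContMDiffAt 𝓘(ℝ, E) 𝓘(ℝ, ℂ) ∞
        (fun y => f (B.index x) y * (g (B.index x) y)⁻¹) x :=
      (hf.contMDiffAt hi).mul ((contDiffAt_inv ℝ hx).comp_contMDiffAt (hg.contMDiffAt hi))
    have hlocal : φ =ᶠ[nhds x] fun y => f (B.index x) y * (g (B.index x) y)⁻¹ := by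
      filter_upwards [B.dom_mem_nhds hi] with y hy
      rw [← div_eq_mul_inv]
      exact hf.div_eq hg (B.mem_dom_index y) hy
    exact ((hquot.congr_of_eventuallyEq hlocal).of_le (by simp)).contMDiffWithinAt
  have hdim := (hK _ φ hg.isOpen_ne_zero hφ).trans_lt
    (show (1 : ℝ≥0∞) < Module.finrank ℝ ℂ by norm_num [Complex.finrank_real_complex])
  obtain ⟨w, hw⟩ := (dense_compl_of_dimH_lt_finrank hdim).nonempty
  refine ⟨-w, fun x hx i hi hgx hsum => hw ⟨x, ⟨hx, ?_⟩, ?_⟩⟩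
  · rwa [mem_ofPred_eq, ← norm_ne_zero_iff, hg.norm_eq (B.mem_dom_index x) hi, norm_ne_zero_iff]
  · rw [show φ x = f i x / g i x from hf.div_eq hg (B.mem_dom_index x) hi, div_eq_iff hgx]
    linear_combination hsum

lemma IsSection.contMDiff_norm_sq (hf : IsSection B f) :
    ContMDiff 𝓘(ℝ, E) 𝓘(ℝ, ℝ) ∞ fun x => ‖f (B.index x) x‖ ^ 2 := fun x => by
  have hi := B.mem_dom_index x
  refine ((contDiff_norm_sq ℝ).comp_contMDiffAt (hf.contMDiffAt hi)).congr_of_eventuallyEq ?_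
  filter_upwards [B.dom_mem_nhds hi] with y hy
  exact congrArg (· ^ 2) (hf.norm_eq (B.mem_dom_index y) hy)

variable [IsManifold 𝓘(ℝ, E) ω M] [FiniteDimensional ℝ E] [T2Space M]

lemma exists_isSection_eventually_ne_zero (B : PrincipalBundle U1 E M P) (x : M) :
    ∃ f, IsSection B f ∧ ∀ᶠ y in nhds x, ∀ i, y ∈ B.dom i → f i y ≠ 0 := by
  have : IsManifold 𝓘(ℝ, E) ∞ M := IsManifold.of_le (n := ω) le_top
  obtain ⟨ρ, -, hρ⟩ := (SmoothBumpFunction.nhds_basis_tsupport (I := 𝓘(ℝ, E)) x).mem_iff.1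
    (B.dom_mem_nhds (B.mem_dom_index x))
  refine ⟨_, isSection_bump ρ.contMDiff hρ, ?_⟩
  filter_upwards [ρ.eventuallyEq_one] with y hy i _
  simp [hy, phase_ne_zero]

lemma exists_isSection_forall_ne_zero (B : PrincipalBundle U1 E M P) {K : Set M}
    (hK : IsCompact K) (hK_dim : IsAtMostOneDim E K) :
    ∃ f, IsSection B f ∧ ∀ x ∈ K, ∀ i, x ∈ B.dom i → f i x ≠ 0 := by
  suffices ∃ f, IsSection B f ∧ ∀ x ∈ K ∩ K, ∀ i, x ∈ B.dom i → f i x ≠ 0 by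
    rwa [inter_self] at this
  refine hK.induction_on (p := fun S => ∃ f, IsSection B f ∧
    ∀ x ∈ K ∩ S, ∀ i, x ∈ B.dom i → f i x ≠ 0) ⟨0, isSection_zero B, by simp⟩ ?_ ?_ ?_
  · rintro S T hST ⟨f, hf, hfT⟩
    exact ⟨f, hf, fun x hx => hfT x ⟨hx.1, hST hx.2⟩⟩
  · rintro S T ⟨f, hf, hfS⟩ ⟨g, hg, hgT⟩
    obtain ⟨z, hz⟩ := hf.exists_forall_add_mul_ne_zero hK_dim hg
    refine ⟨_, hf.add (hg.mul_left (contMDiff_const (c := z))), fun x ⟨hxK, hxST⟩ i hi => ?_⟩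
    by_cases hgx : g i x = 0
    · have hxS : x ∈ S := hxST.resolve_right fun hxT => hgT x ⟨hxK, hxT⟩ i hi hgx
      simpa [hgx] using hfS x ⟨hxK, hxS⟩ i hi
    · exact hz x hxK i hi hgx
  · intro x _
    obtain ⟨f, hf, hfx⟩ := exists_isSection_eventually_ne_zero B x
    exact ⟨_, mem_nhdsWithin_of_mem_nhds hfx, f, hf, fun y hy => hy.2⟩

/-- With `δ` the minimum of `R = |f|²` on `K`, the function `R + expNegInvGlue (δ - R)` is smooth,
positive everywhere, and equal to `R` on `K`: it is safe to divide `f` by its square root. -/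
lemma exists_isSection_norm_eq_one (B : PrincipalBundle U1 E M P) {K : Set M}
    (hK : IsCompact K) (hK_dim : IsAtMostOneDim E K) :
    ∃ f, IsSection B f ∧ ∀ x ∈ K, ∀ i, x ∈ B.dom i → ‖f i x‖ = 1 := by
  obtain ⟨f, hf, hfK⟩ := exists_isSection_forall_ne_zero B hK hK_dim
  set R : M → ℝ := fun x => ‖f (B.index x) x‖ ^ 2
  have hR : ContMDiff 𝓘(ℝ, E) 𝓘(ℝ, ℝ) ∞ R := hf.contMDiff_norm_sq
  obtain ⟨δ, hδ, hδR⟩ : ∃ δ, 0 < δ ∧ ∀ x ∈ K, δ ≤ R x :=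
    hK.exists_forall_le' hR.continuous.continuousOn fun x hx =>
      pow_pos (norm_pos_iff.2 (hfK x hx _ (B.mem_dom_index x))) 2
  have hpos : ∀ x, 0 < R x + expNegInvGlue (δ - R x) := fun x => by
    rcases (sq_nonneg ‖f (B.index x) x‖).eq_or_lt with hx | hx
    · have hRx : R x = 0 := hx.symm
      rw [hRx, zero_add, sub_zero]
      exact expNegInvGlue.pos_of_pos hδ
    · exact add_pos_of_pos_of_nonneg hx (expNegInvGlue.nonneg _)
  have hscale : ContMDiff 𝓘(ℝ, E) 𝓘(ℝ, ℝ) ∞ fun x => (√(R x + expNegInvGlue (δ - R x)))⁻¹ :=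
    fun x => by
      have hglue : ContDiff ℝ ∞ fun r => r + expNegInvGlue (δ - r) :=
        contDiff_id.add (expNegInvGlue.contDiff.comp (contDiff_const.sub contDiff_id))
      have hinv : ContDiffAt ℝ ∞ (fun r => (√(r + expNegInvGlue (δ - r)))⁻¹) (R x) :=
        (hglue.contDiffAt.sqrt (hpos x).ne').inv (Real.sqrt_ne_zero'.2 (hpos x))
      exact hinv.comp_contMDiffAt (hR x)
  refine ⟨_, hf.mul_left (contMDiff_ofReal hscale), fun x hx i hi => ?_⟩
  have hRx : √(R x) = ‖f i x‖ := by
    rw [Real.sqrt_sq (norm_nonneg _), hf.norm_eq (B.mem_dom_index x) hi]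
  rw [expNegInvGlue.zero_of_nonpos (sub_nonpos.2 (hδR x hx)), add_zero, hRx, norm_mul,
    Complex.norm_real, norm_inv, norm_norm, inv_mul_cancel₀ (norm_ne_zero_iff.2 (hfK x hx i hi))]

end LineSections

/-! ### Scalar connection forms -/

section ScalarForms

variable {N : ℕ} {G : Subgroup (Matrix.unitaryGroup (Fin N) ℂ)}

lemma mem_lieAlg_top_of_star_eq_neg {X : Matrix (Fin N) (Fin N) ℂ} (hX : star X = -X) :
    X ∈ lieAlg (⊤ : Subgroup (Matrix.unitaryGroup (Fin N) ℂ)) := fun t =>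
  ⟨⟨⟨_, NormedSpace.exp_mem_unitary_of_mem_skewAdjoint
    (skewAdjoint.smul_mem t (skewAdjoint.mem_iff.2 hX))⟩, trivial⟩, rfl⟩

lemma add_mem_lieAlg_of_commute {X Y : Matrix (Fin N) (Fin N) ℂ} (hXY : Commute X Y)
    (hX : X ∈ lieAlg G) (hY : Y ∈ lieAlg G) : X + Y ∈ lieAlg G := fun t => by
  obtain ⟨g, hg⟩ := hX t
  obtain ⟨h, hh⟩ := hY t
  refine ⟨g * h, ?_⟩
  rw [mat_mul, hg, hh, smul_add, Matrix.exp_add_of_commute _ _ ((hXY.smul_left t).smul_right t)]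

variable {E : Type*} [NormedAddCommGroup E] [NormedSpace ℝ E]
  {M : Type*} [TopologicalSpace M] [ChartedSpace E M] [IsManifold 𝓘(ℝ, E) ω M] {P : Type*}
  {B : PrincipalBundle G E M P} {A : Connection B}
  {η : ∀ x : M, TangentSpace 𝓘(ℝ, E) x →ₗ[ℝ] ℂ} {c : ℝ → M} {u : ℝ → P} {a b : ℝ}

/-- The connection `A + η`, for a global `1`-form `η` with values in the scalar matrices of the
Lie algebra. -/
def Connection.addScalar (A : Connection B) (η : ∀ x : M, TangentSpace 𝓘(ℝ, E) x →ₗ[ℝ] ℂ)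
    (hη : ContMDiff (𝓘(ℝ, E)).tangent 𝓘(ℝ, ℂ) ∞ fun p : TangentBundle 𝓘(ℝ, E) M => η p.1 p.2)
    (hmem : ∀ x v, algebraMap ℂ _ (η x v) ∈ lieAlg G) : Connection B where
  form i x := open Classical in if x ∈ B.dom i then
    A.form i x + (Algebra.linearMap ℂ _).restrictScalars ℝ ∘ₗ η x else 0
  form_mem i x hx v := by
    rw [if_pos hx]
    exact add_mem_lieAlg_of_commute (Algebra.commute_algebraMap_right (η x v) (A.form i x v))
      (A.form_mem i x hx v) (hmem x v)
  smooth_form i k l := by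
    refine ((A.smooth_form i k l).add
      (hη.mul (contMDiff_const (c := (1 : Matrix (Fin N) (Fin N) ℂ) k l))).contMDiffOn).congr
      fun p hp => ?_
    rw [if_pos (show p.1 ∈ B.dom i from hp)]
    simp [Algebra.algebraMap_eq_smul_one]
  form_trans i j x hi hj v := by
    rw [if_pos hi, if_pos hj]
    simp only [LinearMap.add_apply, LinearMap.comp_apply, LinearMap.restrictScalars_apply,
      Algebra.linearMap_apply]
    rw [A.form_trans i j x hi hj v, mul_add, add_mul, ← Algebra.commutes,
      mul_assoc (algebraMap ℂ _ _), mat_inv,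
      star_mat_mul_mat, mul_one]
    exact add_right_comm _ _ _
  form_off i x hx := if_neg hx

variable (hη : ContMDiff (𝓘(ℝ, E)).tangent 𝓘(ℝ, ℂ) ∞ fun p : TangentBundle 𝓘(ℝ, E) M => η p.1 p.2)
  (hmem : ∀ x v, algebraMap ℂ _ (η x v) ∈ lieAlg G)

lemma Connection.addScalar_form {i : B.ι} {x : M} (hx : x ∈ B.dom i)
    (v : TangentSpace 𝓘(ℝ, E) x) :
    (A.addScalar η hη hmem).form i x v = A.form i x v + algebraMap ℂ _ (η x v) :=
  LinearMap.congr_fun (if_pos hx) v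

lemma IsLiftOn.act_addScalar (hc : IsPiecewiseDiff E c a b) (hu : IsLiftOn A c a b u)
    {g : ℝ → G} {z : ℝ → ℂ} (hg : ∀ t ∈ Icc a b, mat (g t) = algebraMap ℂ _ (z t))
    (hz : ContinuousOn z (Icc a b)) (hz' : ∀ᶠ t in Filter.cofinite, t ∈ Ioo a b →
      HasDerivAt z (-(η (c t) (velocity c t) * z t)) t) :
    IsLiftOn (A.addScalar η hη hmem) c a b fun t => B.act (u t) (g t) where
  proj_eq t ht := by rw [B.proj_act, hu.proj_eq t ht]
  continuousOn_coord i := by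
    refine ((hz.mono inter_subset_left).smul (hu.continuousOn_coord i)).congr fun t ht => ?_
    rw [mat_coord_act ((hu.proj_eq t ht.1).symm ▸ ht.2), hg t ht.1, Algebra.smul_def]
    exact (Algebra.commutes _ _).symm
  liftEqAt := by
    filter_upwards [hu.liftEqAt, hz'] with t hlift hzt ht i hi
    have hcoord : (fun s => mat (B.coord i (B.act (u s) (g s)))) =ᶠ[nhds t]
        fun s => z s • mat (B.coord i (u s)) := by
      filter_upwards [eventually_mem_dom hc.continuousOn ht hi] with s hs
      rw [mat_coord_act ((hu.proj_eq s hs.1).symm ▸ hs.2), hg s hs.1, Algebra.smul_def]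
      exact (Algebra.commutes _ _).symm
    refine (((hzt ht).smul (hlift ht i hi)).congr_of_eventuallyEq hcoord).congr_deriv ?_
    rw [Connection.addScalar_form hη hmem hi, hcoord.eq_of_nhds, add_mul, ← Algebra.smul_def]
    simp only [mul_smul_comm, smul_smul, neg_smul, smul_neg, neg_add]

end ScalarForms

/-! ### Covariant derivatives of sections -/

section CovariantDerivative

variable {E : Type*} [NormedAddCommGroup E] [NormedSpace ℝ E]
  {M : Type*} [TopologicalSpace M] [ChartedSpace E M] {P : Type*}
  {B : PrincipalBundle U1 E M P} {f : B.ι → M → ℂ} {i j : B.ι} {x : M}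

lemma mvfderiv_section (hf : IsSection B f) (hi : x ∈ B.dom i) (hj : x ∈ B.dom j)
    (v : TangentSpace 𝓘(ℝ, E) x) :
    mvfderiv 𝓘(ℝ, E) (f i) x v =
      phase (B.trans i j x) * mvfderiv 𝓘(ℝ, E) (f j) x v +
        f j x * mvfderiv 𝓘(ℝ, E) (fun y => mat (B.trans i j y) 0 0) x v := by
  have hprod : f i =ᶠ[nhds x] (fun y => mat (B.trans i j y) 0 0) * f j := by
    filter_upwards [B.dom_mem_nhds hi, B.dom_mem_nhds hj] with y using hf.trans i j y
  have hderiv := ((mdifferentiableAt_trans B hi hj 0 0).hasMFDerivAt.mul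
    ((hf.contMDiffAt hj).mdifferentiableAt (by simp)).hasMFDerivAt).congr_of_eventuallyEq hprod
  exact congrArg (fun L : TangentSpace 𝓘(ℝ, E) x →L[ℝ] ℂ => L v) hderiv.mfderiv

variable [IsManifold 𝓘(ℝ, E) ω M]

/-- The covariant derivative `∇f = df + A f` of a section of the associated line bundle, in the
`i`-th local trivialization. -/
def covDeriv (A : Connection B) (f : B.ι → M → ℂ) (i : B.ι) (x : M) :
    TangentSpace 𝓘(ℝ, E) x →ₗ[ℝ] ℂ :=
  (mvfderiv 𝓘(ℝ, E) (f i) x).toLinearMap +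
    f i x • Matrix.entryLinearMap ℝ ℂ 0 0 ∘ₗ A.form i x

lemma covDeriv_apply (A : Connection B) (f : B.ι → M → ℂ) (i : B.ι) (x : M)
    (v : TangentSpace 𝓘(ℝ, E) x) :
    covDeriv A f i x v = mvfderiv 𝓘(ℝ, E) (f i) x v + f i x * A.form i x v 0 0 :=
  rfl

lemma covDeriv_trans (A : Connection B) (hf : IsSection B f) (hi : x ∈ B.dom i) (hj : x ∈ B.dom j)
    (v : TangentSpace 𝓘(ℝ, E) x) :
    covDeriv A f i x v = phase (B.trans i j x) * covDeriv A f j x v := by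
  have hform : A.form j x v 0 0 =
      star (phase (B.trans i j x)) * A.form i x v 0 0 * phase (B.trans i j x) +
        star (phase (B.trans i j x)) *
          mvfderiv 𝓘(ℝ, E) (fun y => mat (B.trans i j y) 0 0) x v := by
    rw [A.form_trans i j x hi hj v, ← phase_inv]
    simp only [phase, Matrix.add_apply, Matrix.mul_apply, Fin.sum_univ_one]
    rfl
  rw [covDeriv_apply, covDeriv_apply, mvfderiv_section hf hi hj, hf.trans i j x hi hj, hform]
  linear_combination (-(phase (B.trans i j x) * f j x * A.form i x v 0 0) -
    f j x * mvfderiv 𝓘(ℝ, E) (fun y => mat (B.trans i j y) 0 0) x v) *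
      star_phase_mul_phase (B.trans i j x)

lemma star_mul_covDeriv_eq (A : Connection B) (hf : IsSection B f) (hi : x ∈ B.dom i)
    (hj : x ∈ B.dom j) (v : TangentSpace 𝓘(ℝ, E) x) :
    star (f i x) * covDeriv A f i x v = star (f j x) * covDeriv A f j x v := by
  rw [covDeriv_trans A hf hi hj, hf.trans i j x hi hj, star_mul']
  linear_combination star (f j x) * covDeriv A f j x v * star_phase_mul_phase (B.trans i j x)

lemma contMDiffOn_covDeriv (A : Connection B) (hf : IsSection B f) (i : B.ι) :
    ContMDiffOn (𝓘(ℝ, E)).tangent 𝓘(ℝ, ℂ) ∞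
      (fun p : TangentBundle 𝓘(ℝ, E) M => covDeriv A f i p.1 p.2)
      (Bundle.TotalSpace.proj ⁻¹' B.dom i) := by
  have : IsManifold 𝓘(ℝ, E) 1 M := IsManifold.of_le (n := ω) le_top
  have hderiv : ContMDiffOn (𝓘(ℝ, E)).tangent 𝓘(ℝ, ℂ) ∞
      (fun p : TangentBundle 𝓘(ℝ, E) M => mvfderiv 𝓘(ℝ, E) (f i) p.1 p.2)
      (Bundle.TotalSpace.proj ⁻¹' B.dom i) := by
    refine ((contMDiff_snd_tangentBundle_modelSpace (n := ∞) ℂ 𝓘(ℝ, ℂ)).comp_contMDiffOn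
      ((hf.smooth i).contMDiffOn_tangentMapWithin (m := ∞) (by simp)
        (B.isOpen_dom i).uniqueMDiffOn)).congr fun p hp => ?_
    exact congrArg (fun L : TangentSpace 𝓘(ℝ, E) p.1 →L[ℝ] ℂ => L p.2)
      (mfderivWithin_of_isOpen (B.isOpen_dom i) hp).symm
  exact hderiv.add (((hf.smooth i).comp
    (Bundle.contMDiff_proj (TangentSpace 𝓘(ℝ, E))).contMDiffOn fun _ hp => hp).mul
      (A.smooth_form i 0 0))

/-- The imaginary `1`-form `η` such that, where `|f| = 1`, reflection in `f` turns `A` into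
`A + η`. It is `-2 i Im (f̄ ∇f)`, which does not depend on the trivialization. -/
def reflectionForm (A : Connection B) (f : B.ι → M → ℂ) (x : M) :
    TangentSpace 𝓘(ℝ, E) x →ₗ[ℝ] ℂ :=
  (Complex.conjAe.toLinearMap - LinearMap.id) ∘ₗ
    (star (f (B.index x) x) • covDeriv A f (B.index x) x)

lemma reflectionForm_eq (A : Connection B) (hf : IsSection B f) (hi : x ∈ B.dom i)
    (v : TangentSpace 𝓘(ℝ, E) x) : reflectionForm A f x v =
      star (star (f i x) * covDeriv A f i x v) - star (f i x) * covDeriv A f i x v := by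
  rw [star_mul_covDeriv_eq A hf hi (B.mem_dom_index x)]
  rfl

lemma star_reflectionForm (A : Connection B) (f : B.ι → M → ℂ) (x : M)
    (v : TangentSpace 𝓘(ℝ, E) x) : star (reflectionForm A f x v) = -reflectionForm A f x v := by
  simp [reflectionForm]

lemma algebraMap_reflectionForm_mem_lieAlg (A : Connection B) (f : B.ι → M → ℂ) (x : M)
    (v : TangentSpace 𝓘(ℝ, E) x) :
    algebraMap ℂ (Matrix (Fin 1) (Fin 1) ℂ) (reflectionForm A f x v) ∈ lieAlg U1 :=
  mem_lieAlg_top_of_star_eq_neg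
    (by rw [← algebraMap_star_comm, star_reflectionForm, map_neg])

lemma contMDiff_reflectionForm (A : Connection B) (hf : IsSection B f) :
    ContMDiff (𝓘(ℝ, E)).tangent 𝓘(ℝ, ℂ) ∞
      fun p : TangentBundle 𝓘(ℝ, E) M => reflectionForm A f p.1 p.2 := fun p => by
  set i := B.index p.1
  have hnhds : Bundle.TotalSpace.proj ⁻¹' B.dom i ∈ nhds p :=
    (FiberBundle.continuous_proj E (TangentSpace 𝓘(ℝ, E) (M := M))).continuousAt.preimage_mem_nhds
      (B.dom_mem_nhds (B.mem_dom_index p.1))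
  have hstar {s : TangentBundle 𝓘(ℝ, E) M → ℂ}
      (hs : ContMDiffAt (𝓘(ℝ, E)).tangent 𝓘(ℝ, ℂ) ∞ s p) :
      ContMDiffAt (𝓘(ℝ, E)).tangent 𝓘(ℝ, ℂ) ∞ (fun q => star (s q)) p :=
    Complex.conjCLE.contDiff.contMDiff.contMDiffAt.comp p hs
  have hsection : ContMDiffAt (𝓘(ℝ, E)).tangent 𝓘(ℝ, ℂ) ∞
      (fun q : TangentBundle 𝓘(ℝ, E) M => f i q.1) p :=
    (hf.contMDiffAt (B.mem_dom_index p.1)).comp p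
      (Bundle.contMDiff_proj (TangentSpace 𝓘(ℝ, E))).contMDiffAt
  have hprod := (hstar hsection).mul ((contMDiffOn_covDeriv A hf i).contMDiffAt hnhds)
  refine ((hstar hprod).sub hprod).congr_of_eventuallyEq ?_
  filter_upwards [hnhds] with q hq using reflectionForm_eq A hf hq q.2

/-- The connection obtained from `A` by complex conjugation of the line bundle in the frames in
which `f = 1`, where `|f| = 1`. -/
def reflectedConnection (A : Connection B) (hf : IsSection B f) : Connection B :=
  A.addScalar (reflectionForm A f) (contMDiff_reflectionForm A hf)
    (algebraMap_reflectionForm_mem_lieAlg A f)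

end CovariantDerivative

/-! ### Reflection of a connection in a section -/

section Reflection

variable {E : Type*} [NormedAddCommGroup E] [NormedSpace ℝ E]
  {M : Type*} [TopologicalSpace M] [ChartedSpace E M] {P : Type*}
  {B : PrincipalBundle U1 E M P} {f : B.ι → M → ℂ} {i : B.ι} {p : P}

/-- The function on the total space of a `U(1)`-bundle that corresponds to the section `f` of the
associated line bundle. -/
def equivariantFn (f : B.ι → M → ℂ) (p : P) : ℂ :=
  star (phase (B.coord (B.index (B.proj p)) p)) * f (B.index (B.proj p)) (B.proj p)

lemma equivariantFn_eq (hf : IsSection B f) (hi : B.proj p ∈ B.dom i) :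
    equivariantFn f p = star (phase (B.coord i p)) * f i (B.proj p) := by
  have hj := B.mem_dom_index (B.proj p)
  rw [equivariantFn, B.coord_eq i _ p hi hj, hf.trans i _ _ hi hj, phase_mul, star_mul']
  linear_combination -(star (phase (B.coord (B.index (B.proj p)) p)) *
    f (B.index (B.proj p)) (B.proj p)) * star_phase_mul_phase (B.trans i _ (B.proj p))

lemma equivariantFn_act (hf : IsSection B f) (p : P) (g : U1) :
    equivariantFn f (B.act p g) = star (phase g) * equivariantFn f p := by
  have hi := B.mem_dom_index (B.proj p)
  rw [equivariantFn_eq hf (i := B.index (B.proj p)) (by rwa [B.proj_act]), B.proj_act,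
    B.coord_act _ p g hi, phase_mul, star_mul', equivariantFn]
  ring

lemma norm_equivariantFn (f : B.ι → M → ℂ) (p : P) :
    ‖equivariantFn f p‖ = ‖f (B.index (B.proj p)) (B.proj p)‖ := by
  rw [equivariantFn, norm_mul, norm_star, norm_phase, one_mul]

lemma hasDerivAt_sq_of_norm_eq_one {φ : ℝ → ℂ} {φ' : ℂ} {t : ℝ} (hφ : HasDerivAt φ φ' t)
    (hnorm : ∀ᶠ s in nhds t, ‖φ s‖ = 1) :
    HasDerivAt (fun s => φ s ^ 2)
      (-((star (star (φ t) * φ') - star (φ t) * φ') * φ t ^ 2)) t := by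
  have hone : (star φ * φ) =ᶠ[nhds t] fun _ => 1 := by
    filter_upwards [hnorm] with s hs
    rw [Pi.mul_apply, Pi.star_apply, RCLike.star_def, Complex.conj_mul', hs]
    norm_num
  have himag : star φ' * φ t + star (φ t) * φ' = 0 :=
    (hφ.star.mul hφ).unique ((hasDerivAt_const t (1 : ℂ)).congr_of_eventuallyEq hone)
  have hone_t : star (φ t) * φ t = 1 := hone.eq_of_nhds
  refine (hφ.pow 2).congr_deriv ?_
  rw [star_mul', star_star]
  push_cast
  linear_combination φ t ^ 2 * himag - 2 * φ t * φ' * hone_t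

variable [IsManifold 𝓘(ℝ, E) ω M] {A : Connection B} {c : ℝ → M} {u : ℝ → P} {a b t : ℝ}

lemma IsLiftOn.continuousOn_equivariantFn (hf : IsSection B f) (hc : ContinuousOn c (Icc a b))
    (hu : IsLiftOn A c a b u) : ContinuousOn (fun t => equivariantFn f (u t)) (Icc a b) := by
  intro t ht
  set i := B.index (c t)
  have hi : c t ∈ B.dom i := B.mem_dom_index (c t)
  have hlocal : ContinuousOn (fun s => star (phase (B.coord i (u s))) * f i (c s))
      (Icc a b ∩ c ⁻¹' B.dom i) :=
    (continuousOn_matrix.1 (hu.continuousOn_coord i) 0 0).star.mul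
      ((hf.smooth i).continuousOn.comp (hc.mono inter_subset_left) fun s hs => hs.2)
  have heq : EqOn (fun s => equivariantFn f (u s))
      (fun s => star (phase (B.coord i (u s))) * f i (c s)) (Icc a b ∩ c ⁻¹' B.dom i) :=
    fun s hs => by
      have hproj := hu.proj_eq s hs.1
      simp only [equivariantFn_eq hf (show B.proj (u s) ∈ B.dom i from hproj ▸ hs.2), hproj]
  exact ((hlocal.congr heq) t ⟨ht, hi⟩).mono_of_mem_nhdsWithin
    (inter_preimage_dom_mem_nhdsWithin (hc t ht) hi)

lemma LiftEqAt.hasDerivAt_equivariantFn (hf : IsSection B f) (hi : c t ∈ B.dom i)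
    (hu : LiftEqAt A c u i t) (hc : MDifferentiableAt 𝓘(ℝ, ℝ) 𝓘(ℝ, E) c t)
    (hproj : ∀ᶠ s in nhds t, B.proj (u s) = c s) :
    HasDerivAt (fun s => equivariantFn f (u s))
      (star (phase (B.coord i (u t))) * covDeriv A f i (c t) (velocity c t)) t := by
  have heq : (fun s => equivariantFn f (u s)) =ᶠ[nhds t]
      fun s => star (phase (B.coord i (u s))) * f i (c s) := by
    filter_upwards [hproj, hc.continuousAt.preimage_mem_nhds (B.dom_mem_nhds hi)] with s hs hsi
    rw [equivariantFn_eq hf (show B.proj (u s) ∈ B.dom i from hs ▸ hsi), hs]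
  have hform : star (A.form i (c t) (velocity c t) 0 0) = -A.form i (c t) (velocity c t) 0 0 :=
    congrFun₂ (star_eq_neg_of_mem_lieAlg (A.form_mem i (c t) hi _)) 0 0
  have hsection : HasDerivAt (fun s => f i (c s)) (mvfderiv 𝓘(ℝ, E) (f i) (c t) (velocity c t)) t :=
    hasDerivAt_comp_velocity ((hf.contMDiffAt hi).mdifferentiableAt (by simp)) hc
  have hcoord := hasDerivAt_matrix.1 hu 0 0
  refine ((hcoord.star.mul hsection).congr_of_eventuallyEq heq).congr_deriv ?_
  rw [covDeriv_apply, Matrix.neg_apply, Matrix.mul_apply, Fin.sum_univ_one, star_neg, star_mul',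
    hform]
  simp only [phase]
  ring

lemma IsLiftOn.hasDerivAt_equivariantFn_sq (hf : IsSection B f) (hc : IsPiecewiseDiff E c a b)
    (hnorm : ∀ t ∈ Icc a b, ∀ i, c t ∈ B.dom i → ‖f i (c t)‖ = 1) (hu : IsLiftOn A c a b u) :
    ∀ᶠ t in Filter.cofinite, t ∈ Ioo a b → HasDerivAt (fun s => equivariantFn f (u s) ^ 2)
      (-(reflectionForm A f (c t) (velocity c t) * equivariantFn f (u t) ^ 2)) t := by
  filter_upwards [hu.liftEqAt, hc.mdifferentiableAt] with t hlift hct ht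
  have hIcc : ∀ᶠ s in nhds t, s ∈ Icc a b := Icc_mem_nhds ht.1 ht.2
  have hproj := hu.proj_eq t hIcc.self_of_nhds
  set i := B.index (c t)
  have hi : c t ∈ B.dom i := B.mem_dom_index (c t)
  have hderiv := (hlift ht i hi).hasDerivAt_equivariantFn hf hi (hct ht) (hIcc.mono hu.proj_eq)
  have hone : ∀ᶠ s in nhds t, ‖equivariantFn f (u s)‖ = 1 := hIcc.mono fun s hs => by
    rw [norm_equivariantFn, hu.proj_eq s hs, hnorm s hs _ (B.mem_dom_index _)]
  have hinvariant : star (equivariantFn f (u t)) * (star (phase (B.coord i (u t))) *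
        covDeriv A f i (c t) (velocity c t)) =
      star (f i (c t)) * covDeriv A f i (c t) (velocity c t) := by
    rw [equivariantFn_eq hf (hproj ▸ hi), hproj, star_mul', star_star]
    linear_combination star (f i (c t)) * covDeriv A f i (c t) (velocity c t) *
      star_phase_mul_phase (B.coord i (u t))
  rw [reflectionForm_eq A hf hi, ← hinvariant]
  exact hasDerivAt_sq_of_norm_eq_one hderiv hone

lemma IsLiftOn.exists_reflected (hf : IsSection B f) (hc : IsPiecewiseDiff E c a b)
    (hnorm : ∀ t ∈ Icc a b, ∀ i, c t ∈ B.dom i → ‖f i (c t)‖ = 1) (hu : IsLiftOn A c a b u) :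
    ∃ g : ℝ → U1, (∀ t ∈ Icc a b, phase (g t) = equivariantFn f (u t) ^ 2) ∧
      IsLiftOn (reflectedConnection A hf) c a b fun t => B.act (u t) (g t) := by
  have hexists : ∀ t ∈ Icc a b, ∃ g : U1, phase g = equivariantFn f (u t) ^ 2 := fun t ht => by
    refine exists_phase_eq ?_
    rw [norm_pow, norm_equivariantFn, hu.proj_eq t ht, hnorm t ht _ (B.mem_dom_index _), one_pow]
  choose! g hg using hexists
  refine ⟨g, hg, hu.act_addScalar _ _ hc (fun t ht => ?_)
    ((hu.continuousOn_equivariantFn hf hc.continuousOn).pow 2)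
    (hu.hasDerivAt_equivariantFn_sq hf hc hnorm)⟩
  rw [mat_eq_algebraMap_phase, hg t ht]
  rfl

lemma holonomy_reflectedConnection (hf : IsSection B f) {u₀ : P} {γ : PLoop E (B.proj u₀)}
    (hnorm : ∀ t ∈ Icc γ.a γ.b, ∀ i, γ.toFun t ∈ B.dom i → ‖f i (γ.toFun t)‖ = 1) :
    holonomy (reflectedConnection A hf) u₀ γ = (holonomy A u₀ γ)⁻¹ := by
  obtain ⟨u, hu, hu_left, hu_right⟩ := holonomy_spec IsU1OrSU2.u1 A u₀ γ
  obtain ⟨g, hg, hug⟩ := hu.exists_reflected hf γ.isPiecewiseDiff hnorm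
  set H := holonomy A u₀ γ
  have hequiv : equivariantFn f u₀ = star (phase H) * equivariantFn f (u γ.b) := by
    rw [← equivariantFn_act hf, ← hu_right]
  have hg_ends : g γ.a = H⁻¹ * H⁻¹ * g γ.b := phase_injective <| by
    rw [phase_mul, phase_mul, phase_inv, hg _ (left_mem_Icc.2 γ.le), hg _ (right_mem_Icc.2 γ.le),
      hu_left, hequiv]
    ring
  refine holonomy_eq IsU1OrSU2.u1 (hug.act γ.continuousOn (g γ.a)⁻¹) ?_ ?_
  · rw [hu_left, ← B.act_mul, mul_inv_cancel, B.act_one]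
  · rw [← B.act_mul, ← B.act_mul, hg_ends]
    nth_rewrite 1 [hu_right]
    congr 1
    group

lemma exists_holonomy_eq_inv [FiniteDimensional ℝ E] [T2Space M] (A : Connection B) (u₀ : P)
    {n : ℕ} (γ : Fin n → PLoop E (B.proj u₀)) :
    ∃ A' : Connection B, ∀ k, holonomy A' u₀ (γ k) = (holonomy A u₀ (γ k))⁻¹ := by
  obtain ⟨f, hf, hnorm⟩ := exists_isSection_norm_eq_one B
    (isCompact_iUnion fun k => isCompact_Icc.image_of_continuousOn (γ k).continuousOn)
    (IsAtMostOneDim.iUnion fun k =>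
      IsPiecewiseAnalytic.isAtMostOneDim (γ k).piecewise_analytic)
  exact ⟨reflectedConnection A hf, fun k => holonomy_reflectedConnection hf fun t ht =>
    hnorm _ (mem_iUnion.2 ⟨k, mem_image_of_mem _ ht⟩)⟩

end Reflection

/-! ### Wilson functions and generalized connections -/

section Trace

variable {N : ℕ} {G : Subgroup (Matrix.unitaryGroup (Fin N) ℂ)}

lemma trace_mat_inv (g : G) : (mat g⁻¹).trace = star (mat g).trace := by
  rw [mat_inv, Matrix.star_eq_conjTranspose, Matrix.trace_conjTranspose]

lemma trace_mul_U1 (g h : U1) : (mat (g * h)).trace = (mat g).trace * (mat h).trace := by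
  simp [mat_mul, Matrix.trace_fin_one, Matrix.mul_apply]

lemma mat_inv_SU_two (g : SU 2) : mat g⁻¹ = (mat g).adjugate := by
  have hdet : (mat g).det = 1 := g.2
  calc mat g⁻¹ = mat g⁻¹ * (mat g * (mat g).adjugate) := by
        rw [Matrix.mul_adjugate, hdet, one_smul, mul_one]
    _ = (mat g).adjugate := by
        rw [← mul_assoc, mat_inv, star_mat_mul_mat, one_mul]

lemma mat_add_mat_inv_SU_two (g : SU 2) : mat g + mat g⁻¹ = (mat g).trace • 1 := by
  rw [mat_inv_SU_two, Matrix.adjugate_fin_two]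
  ext i j
  fin_cases i <;> fin_cases j <;> simp [Matrix.trace_fin_two, add_comm]

lemma trace_mat_inv_SU_two (g : SU 2) : (mat g⁻¹).trace = (mat g).trace := by
  have h := congrArg Matrix.trace (mat_add_mat_inv_SU_two g)
  rw [Matrix.trace_add, Matrix.trace_smul, Matrix.trace_one, Fintype.card_fin, smul_eq_mul,
    Nat.cast_ofNat] at h
  linear_combination h

lemma trace_mul_trace_SU_two (g h : SU 2) :
    (mat g).trace * (mat h).trace = (mat (g * h)).trace + (mat (g * h⁻¹)).trace := by
  rw [← Matrix.trace_add, mat_mul, mat_mul, ← mul_add, mat_add_mat_inv_SU_two, mul_smul_comm,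
    mul_one, Matrix.trace_smul, smul_eq_mul, mul_comm]

end Trace

section Wilson

variable {N : ℕ} {G : Subgroup (Matrix.unitaryGroup (Fin N) ℂ)}
  {E : Type*} [NormedAddCommGroup E] [NormedSpace ℝ E]
  {M : Type*} [TopologicalSpace M] [ChartedSpace E M] [IsManifold 𝓘(ℝ, E) ω M] {P : Type*}
  {B : PrincipalBundle G E M P} {u₀ : P}

lemma wilson_apply (γ : PLoop E (B.proj u₀)) (A : Connection B) :
    wilson B u₀ γ A = (1 / (N : ℂ)) * (mat (holonomy A u₀ γ)).trace := rfl

lemma wilson_const (hG : IsU1OrSU2 G) : wilson B u₀ (PLoop.const (B.proj u₀)) = 1 := by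
  have hN : (N : ℂ) ≠ 0 := by cases hG <;> norm_num
  ext A
  rw [wilson_apply, holonomy_const hG, mat_one, Matrix.trace_one, Fintype.card_fin,
    one_div_mul_cancel hN, BoundedContinuousFunction.coe_one, Pi.one_apply]

lemma star_wilson (hG : IsU1OrSU2 G) (γ : PLoop E (B.proj u₀)) :
    star (wilson B u₀ γ) = wilson B u₀ γ.inv := by
  ext A
  rw [BoundedContinuousFunction.star_apply, wilson_apply, wilson_apply, holonomy_inv hG,
    trace_mat_inv]
  simp

lemma wilson_mul_wilson_U1 {B : PrincipalBundle U1 E M P} (γ δ : PLoop E (B.proj u₀)) :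
    wilson B u₀ γ * wilson B u₀ δ = wilson B u₀ (γ.mul δ) := by
  ext A
  simp [wilson_apply, holonomy_mul .u1, trace_mul_U1]

lemma wilson_mul_wilson_SU_two {B : PrincipalBundle (SU 2) E M P} (γ δ : PLoop E (B.proj u₀)) :
    wilson B u₀ γ * wilson B u₀ δ =
      (1 / 2 : ℂ) • (wilson B u₀ (γ.mul δ) + wilson B u₀ (γ.mul δ.inv)) := by
  ext A
  simp only [BoundedContinuousFunction.mul_apply, BoundedContinuousFunction.smul_apply,
    BoundedContinuousFunction.add_apply, wilson_apply, holonomy_mul .su2, holonomy_inv .su2,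
    smul_eq_mul, Nat.cast_ofNat]
  rw [← mul_add, ← trace_mul_trace_SU_two]
  ring

lemma wilson_mul_mem_span (hG : IsU1OrSU2 G) (γ δ : PLoop E (B.proj u₀)) :
    wilson B u₀ γ * wilson B u₀ δ ∈ Submodule.span ℂ (wilsonSet B u₀) := by
  have hmem : ∀ γ, wilson B u₀ γ ∈ Submodule.span ℂ (wilsonSet B u₀) :=
    fun γ => Submodule.subset_span ⟨γ, rfl⟩
  cases hG with
  | u1 => exact wilson_mul_wilson_U1 γ δ ▸ hmem _
  | su2 =>
    rw [wilson_mul_wilson_SU_two]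
    exact Submodule.smul_mem _ _ (add_mem (hmem _) (hmem _))

lemma span_wilsonSet_mul_le (hG : IsU1OrSU2 G) :
    Submodule.span ℂ (wilsonSet B u₀) * Submodule.span ℂ (wilsonSet B u₀) ≤
      Submodule.span ℂ (wilsonSet B u₀) := by
  rw [Submodule.span_mul_span, Submodule.span_le]
  rintro _ ⟨_, ⟨γ, rfl⟩, _, ⟨δ, rfl⟩, rfl⟩
  exact wilson_mul_mem_span hG γ δ

lemma star_wilsonSet (hG : IsU1OrSU2 G) : star (wilsonSet B u₀) = wilsonSet B u₀ := by
  have hsub : star (wilsonSet B u₀) ⊆ wilsonSet B u₀ := by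
    rw [Set.star_subset]
    rintro _ ⟨γ, rfl⟩
    exact ⟨γ.inv, (star_wilson hG γ).symm⟩
  exact hsub.antisymm (Set.star_subset.1 hsub)

lemma adjoin_wilsonSet_eq_span (hG : IsU1OrSU2 G) :
    (StarAlgebra.adjoin ℂ (wilsonSet B u₀) : Set (BddFun B)) =
      Submodule.span ℂ (wilsonSet B u₀) := by
  have hspan : Subalgebra.toSubmodule (StarAlgebra.adjoin ℂ (wilsonSet B u₀)).toSubalgebra =
      Submodule.span ℂ (wilsonSet B u₀) := by
    rw [StarAlgebra.adjoin_eq_span, star_wilsonSet hG, union_self]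
    refine le_antisymm (Submodule.span_le.2 fun f hf => ?_)
      (Submodule.span_mono Submonoid.subset_closure)
    induction hf using Submonoid.closure_induction with
    | mem f hf => exact Submodule.subset_span hf
    | one => exact Submodule.subset_span ⟨_, wilson_const hG⟩
    | mul f g _ _ hf hg => exact span_wilsonSet_mul_le hG (Submodule.mul_mem_mul hf hg)
  exact congrArg (fun V : Submodule ℂ (BddFun B) => (V : Set (BddFun B))) hspan

end Wilson

section Gelfand

open WeakDual

variable {𝓐 : Type*} [CommCStarAlgebra 𝓐]

lemma norm_gelfandStarTransform (a : 𝓐) : ‖gelfandStarTransform 𝓐 a‖ = ‖a‖ :=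
  (gelfandTransform_isometry 𝓐).norm_map_of_map_zero (map_zero _) a

lemma dense_span_gelfandStarTransform {W : Type*} {w : W → 𝓐}
    (hw : Dense (Submodule.span ℂ (range w) : Set 𝓐)) :
    Dense (Submodule.span ℂ (range fun T => gelfandStarTransform 𝓐 (w T)) :
      Set C(characterSpace ℂ 𝓐, ℂ)) := by
  have himage := (gelfandStarTransform 𝓐).surjective.denseRange.dense_image
    (gelfandTransform_isometry 𝓐).continuous hw
  have hmap := Submodule.map_span (gelfandTransform ℂ 𝓐).toLinearMap (range w)
  rw [← range_comp] at hmap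
  exact himage.mono (congrArg SetLike.coe hmap).le

lemma dense_of_forall_apply_eq_zero {S : Set (characterSpace ℂ 𝓐)}
    (hS : ∀ a : 𝓐, (∀ φ ∈ S, φ a = 0) → a = 0) : Dense S := by
  intro φ
  by_contra hφ
  obtain ⟨f, hf_zero, hf_one, -⟩ := exists_continuous_zero_one_of_isClosed isClosed_closure
    isClosed_singleton (disjoint_singleton_right.2 hφ)
  obtain ⟨a, ha⟩ := (gelfandStarTransform 𝓐).surjective
    ((ContinuousMap.mk Complex.ofReal Complex.continuous_ofReal).comp f)
  have happly : ∀ ψ : characterSpace ℂ 𝓐, ψ a = f ψ := fun ψ => DFunLike.congr_fun ha ψ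
  have ha_zero : a = 0 := hS a fun ψ hψ => by
    rw [happly, hf_zero (subset_closure hψ), Pi.zero_apply, Complex.ofReal_zero]
  have hφa := happly φ
  rw [ha_zero, map_zero, hf_one rfl] at hφa
  simp at hφa

end Gelfand

section GeneralizedConnections

variable {N : ℕ} {G : Subgroup (Matrix.unitaryGroup (Fin N) ℂ)}
  {E : Type*} [NormedAddCommGroup E] [NormedSpace ℝ E]
  {M : Type*} [TopologicalSpace M] [ChartedSpace E M] [IsManifold 𝓘(ℝ, E) ω M] {P : Type*}
  {B : PrincipalBundle G E M P} {u₀ : P}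

instance : CommCStarAlgebra (Hol B u₀) :=
  StarSubalgebra.commCStarAlgebra _ (h_closed := isClosed_Hol B u₀)

/-- A Wilson function as an element of the holonomy C*-algebra. -/
def wilsonElt (T : wilsonSet B u₀) : Hol B u₀ := ⟨T, wilsonSet_subset_Hol B u₀ T.2⟩

lemma norm_wilsonElt_le (T : wilsonSet B u₀) : ‖wilsonElt T‖ ≤ ‖(1 / (N : ℂ))‖ * N := by
  obtain ⟨_, γ, rfl⟩ := T
  exact (BoundedContinuousFunction.norm_le (by positivity)).2 fun A => norm_trace_le _

lemma dense_span_wilsonElt (hG : IsU1OrSU2 G) :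
    Dense (Submodule.span ℂ (range (wilsonElt (B := B) (u₀ := u₀))) : Set (Hol B u₀)) := by
  let incl : Hol B u₀ →ₗ[ℂ] BddFun B := (Hol B u₀).subtype
  have hrange : incl '' range wilsonElt = wilsonSet B u₀ := by
    rw [← range_comp]
    exact Subtype.range_coe
  have hmap : (Submodule.span ℂ (range wilsonElt)).map incl =
      Submodule.span ℂ (wilsonSet B u₀) := by
    rw [Submodule.map_span, hrange]
  have himage := (congrArg SetLike.coe hmap).trans (adjoin_wilsonSet_eq_span hG).symm
  intro f
  rw [closure_subtype]
  exact (congrArg closure himage).ge f.2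

/-- The generalized connection given by a connection. -/
def toGenConn (u₀ : P) (A : Connection B) : GenConn B u₀ :=
  WeakDual.CharacterSpace.equivAlgHom.symm
    { toFun := fun f => (f : BddFun B) A
      map_one' := rfl
      map_mul' := fun _ _ => rfl
      map_zero' := rfl
      map_add' := fun _ _ => rfl
      commutes' := fun _ => by simp [Algebra.algebraMap_eq_smul_one] }

theorem denseRange_toGenConn : DenseRange (toGenConn (B := B) u₀) :=
  dense_of_forall_apply_eq_zero fun _ hf =>
    Subtype.ext (BoundedContinuousFunction.ext fun A => hf _ ⟨A, rfl⟩)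

lemma forall_genConn_nonneg_iff {F : GenConn B u₀ → ℂ} (hF : Continuous F) :
    (∀ Abar, 0 ≤ F Abar) ↔ ∀ A, 0 ≤ F (toGenConn u₀ A) :=
  ⟨fun h _ => h _, fun h Abar =>
    denseRange_toGenConn.induction_on Abar (isClosed_le continuous_const hF) h⟩

variable (B u₀) in
/-- The Gelfand transform `Ā ↦ T(Ā)` of a Wilson function. -/
def gelfandWilson (T : wilsonSet B u₀) : C(GenConn B u₀, ℂ) :=
  gelfandStarTransform (Hol B u₀) (wilsonElt T)

@[simp]
lemma gelfandWilson_apply (T : wilsonSet B u₀) (Abar : GenConn B u₀) :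
    gelfandWilson B u₀ T Abar = evalAt T Abar := rfl

lemma evalAt_toGenConn (T : wilsonSet B u₀) (A : Connection B) :
    evalAt T (toGenConn u₀ A) = (T : BddFun B) A := rfl

@[fun_prop]
lemma continuous_evalAt (T : wilsonSet B u₀) :
    Continuous fun Abar : GenConn B u₀ => evalAt T Abar :=
  (gelfandWilson B u₀ T).continuous

lemma norm_gelfandWilson_le (T : wilsonSet B u₀) :
    ‖gelfandWilson B u₀ T‖ ≤ ‖(1 / (N : ℂ))‖ * N :=
  (norm_gelfandStarTransform _).trans_le (norm_wilsonElt_le T)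

lemma dense_span_gelfandWilson (hG : IsU1OrSU2 G) :
    Dense (Submodule.span ℂ (range (gelfandWilson B u₀)) : Set C(GenConn B u₀, ℂ)) :=
  dense_span_gelfandStarTransform (dense_span_wilsonElt hG)

lemma one_mem_span_gelfandWilson (hG : IsU1OrSU2 G) :
    1 ∈ Submodule.span ℂ (range (gelfandWilson B u₀)) :=
  Submodule.subset_span ⟨⟨1, _, wilson_const hG⟩, map_one (gelfandStarTransform (Hol B u₀))⟩

lemma range_star_gelfandWilson (hG : IsU1OrSU2 G) :
    range (fun T => star (gelfandWilson B u₀ T)) = range (gelfandWilson B u₀) := by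
  have hsub : range (gelfandWilson B u₀) ⊆ star (range (gelfandWilson B u₀)) := by
    rintro _ ⟨T, rfl⟩
    have hT : star (T : BddFun B) ∈ wilsonSet B u₀ :=
      (star_wilsonSet hG).subset (star_mem_star.2 T.2)
    exact ⟨⟨_, hT⟩, map_star (gelfandStarTransform (Hol B u₀)) (wilsonElt T)⟩
  rw [range_comp' star, image_star]
  exact (star_subset.2 hsub).antisymm hsub

lemma star_mem_span_gelfandWilson (hG : IsU1OrSU2 G) :
    ∀ f ∈ Submodule.span ℂ (range (gelfandWilson B u₀)),
      star f ∈ Submodule.span ℂ (range (gelfandWilson B u₀)) := by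
  intro f hf
  have hstar := Submodule.mem_map_of_mem
    (f := (starLinearEquiv ℂ (A := C(GenConn B u₀, ℂ))).toLinearMap) hf
  rw [Submodule.map_span, ← range_comp] at hstar
  rwa [← range_star_gelfandWilson hG]

lemma exists_wilson_eq_star [FiniteDimensional ℝ E] [T2Space M] (hG : IsU1OrSU2 G)
    (A : Connection B) {n : ℕ} (T : Fin n → wilsonSet B u₀) :
    ∃ A' : Connection B, ∀ k, (T k : BddFun B) A' = star ((T k : BddFun B) A) := by
  choose γ hγ using fun k => (T k).2
  cases hG with
  | u1 =>
    obtain ⟨A', hA'⟩ := exists_holonomy_eq_inv A u₀ γ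
    refine ⟨A', fun k => ?_⟩
    rw [← hγ k, wilson_apply, wilson_apply, hA', trace_mat_inv]
    simp
  | su2 =>
    refine ⟨A, fun k => ?_⟩
    rw [← BoundedContinuousFunction.star_apply, ← hγ k, star_wilson .su2, wilson_apply,
      wilson_apply, holonomy_inv .su2, trace_mat_inv_SU_two]

theorem posDefOf_star_gelfandWilson [FiniteDimensional ℝ E] [T2Space M] (hG : IsU1OrSU2 G) :
    PosDefOf (fun T => star (gelfandWilson B u₀ T)) = PosDef B u₀ := by
  ext ℓ
  refine forall_congr' fun n => forall_congr' fun c => forall_congr' fun T => imp_congr_left ?_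
  simp only [ContinuousMap.star_apply, gelfandWilson_apply]
  rw [forall_genConn_nonneg_iff (by fun_prop), forall_genConn_nonneg_iff (by fun_prop)]
  simp only [evalAt_toGenConn]
  constructor <;> intro h A <;> obtain ⟨A', hA'⟩ := exists_wilson_eq_star hG A T <;>
    simpa only [hA', star_star] using h A'

end GeneralizedConnections

end LoopTransform

end

open LoopTransform in
theorem mainTheorem2_general {N : ℕ} (G : Subgroup (Matrix.unitaryGroup (Fin N) ℂ))
    (hG : IsU1OrSU2 G)
    {E : Type*} [NormedAddCommGroup E] [NormedSpace ℝ E] [FiniteDimensional ℝ E]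
    {M : Type*} [TopologicalSpace M] [T2Space M] [ChartedSpace E M] [IsManifold 𝓘(ℝ, E) ω M]
    {P : Type*} (B : PrincipalBundle G E M P) (u₀ : P) :
    ∃ L : RegMeas (GenConn B u₀) →L[ℂ] lp (fun _ : wilsonSet B u₀ => ℂ) ∞,
      (∀ μ (T : wilsonSet B u₀),
        L μ T = cintegral (μ : ComplexMeasure (GenConn B u₀)) (fun Abar => star (evalAt T Abar))) ∧
      Function.Injective L ∧
      Set.BijOn (fun μ => (L μ : wilsonSet B u₀ → ℂ)) (PosMeas (GenConn B u₀)) (PosDef B u₀) := by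
  let e := fun T => star (gelfandWilson B u₀ T)
  have hrange : range e = range (gelfandWilson B u₀) := range_star_gelfandWilson hG
  have hbound : ∀ T, ‖e T‖ ≤ ‖(1 / (N : ℂ))‖ * N := fun T =>
    (norm_star _).trans_le (norm_gelfandWilson_le T)
  have hdense : Dense (Submodule.span ℂ (range e) : Set C(GenConn B u₀, ℂ)) :=
    hrange ▸ dense_span_gelfandWilson hG
  refine ⟨transform e hbound, fun _ _ => rfl, transform_injective hbound hdense, ?_⟩
  rw [← posDefOf_star_gelfandWilson hG]
  exact bijOn_transform hbound hdense
    (hrange ▸ one_mem_span_gelfandWilson hG)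
    (hrange ▸ star_mem_span_gelfandWilson hG)

theorem mainTheorem2 {N : ℕ} (G : Subgroup (Matrix.unitaryGroup (Fin N) ℂ))
    (hG : LoopTransform.IsU1OrSU2 G)
    {E : Type*} [NormedAddCommGroup E] [NormedSpace ℝ E] [FiniteDimensional ℝ E]
    {M : Type*} [TopologicalSpace M] [T2Space M] [SecondCountableTopology M]
    [ChartedSpace E M] [IsManifold 𝓘(ℝ, E) ω M]
    {P : Type*} (B : LoopTransform.PrincipalBundle G E M P) (u₀ : P) :
    ∃ L : LoopTransform.RegMeas (LoopTransform.GenConn B u₀) →L[ℂ]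
        lp (fun _ : LoopTransform.wilsonSet B u₀ => ℂ) ∞,
      (∀ μ (T : LoopTransform.wilsonSet B u₀),
        L μ T = LoopTransform.cintegral (μ : ComplexMeasure (LoopTransform.GenConn B u₀))
          (fun Abar => star (LoopTransform.evalAt T Abar))) ∧
      Function.Injective L ∧
      Set.BijOn (fun μ => (L μ : LoopTransform.wilsonSet B u₀ → ℂ))
        (LoopTransform.PosMeas (LoopTransform.GenConn B u₀)) (LoopTransform.PosDef B u₀) :=
  mainTheorem2_general G hG B u₀
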